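/- Let $P_k$ denote the path with $k$ vertices and $k-1$ edges. For graphs $K$ and $\Gamma$, a $(K,\Gamma)$-design is a set of subgraphs of $K$ (its blocks), each isomorphic to $\Gamma$, whose edge sets partition the edge set of $K$; a $\Gamma$-design of order $v$ is a $(K_v,\Gamma)$-design, where $K_v$ is a complete graph on some set of $v$ vertices. A $P_5$-design $\mathcal B$ can be down-linked to a $P_4$-design $\mathcal B'$ if there is a function $f:\mathcal B\to\mathcal B'$ (a down-link) such that $f(B)$ is a subgraph of $B$ for every $B\in\mathcal B$; no relation is required between the vertex sets of the two complete graphs. Call $v$ admissible if a $P_5$-design of order $v$ exists. Let $\mathcal L_1P_5(v)$ be the set of all integers $n$ such that some $P_5$-design of order $v$ can be down-linked to a $P_4$-design of order $n$, and let $\mathcal L_2P_5(v)$ be the set of all integers $n$ such that every $P_5$-design of order $v$ can be down-linked to some $P_4$-design of order $n$. Theorem. For every admissible $v>1$, $$\mathcal L_1P_5(v)=\{n\ge v-1 : n\equiv 0,1 \pmod 3\},$$ $$\{n\ge v+2 : n\equiv 0,1 \pmod 3\}\subseteq \mathcal L_2P_5(v)\subseteq \{n\ge v : n\equiv 0,1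 \pmod 3\}.$$ -/

import Mathlib

namespace DownLink

/-- The graphs under consideration: simple graphs whose vertices are natural numbers, that is, a
vertex set `verts ⊆ ℕ` with an irreflexive symmetric adjacency on it. The order `≤` is the
(not necessarily induced) subgraph relation, and `edgeSet` is the set of edges. -/
abbrev NatGraph : Type := (⊤ : SimpleGraph ℕ).Subgraph

/-- The complete graph with vertex set `S`. -/
def completeOn (S : Finset ℕ) : NatGraph :=
  (⊤ : (⊤ : SimpleGraph ℕ).Subgraph).induce (S : Set ℕ)

/-- `𝓑` is a `(K, Γ)`-design (a `Γ`-decomposition of `K`): a set of subgraphs of `K`, each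
isomorphic to `Γ`, whose edge sets partition the edge set of `K`. -/
structure IsDesign {W : Type} (K : NatGraph) (Γ : SimpleGraph W) (𝓑 : Set NatGraph) : Prop where
  le : ∀ B ∈ 𝓑, B ≤ K
  iso : ∀ B ∈ 𝓑, Nonempty (B.coe ≃g Γ)
  partition : ∀ e ∈ K.edgeSet, ∃! B, B ∈ 𝓑 ∧ e ∈ B.edgeSet

/-- A `Γ`-design of order `v` is a `(K_v, Γ)`-design, where `K_v` is a complete graph on some
`v` vertices. Here `𝓑` is a `Γ`-design of order `v`. -/
def IsDesignOfOrder {W : Type} (Γ : SimpleGraph W) (v : ℕ) (𝓑 : Set NatGraph) : Prop :=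
  ∃ S : Finset ℕ, S.card = v ∧ IsDesign (completeOn S) Γ 𝓑

/-- `v` is admissible for `Γ` if a `Γ`-design of order `v` exists. -/
def Admissible {W : Type} (Γ : SimpleGraph W) (v : ℕ) : Prop :=
  ∃ 𝓑 : Set NatGraph, IsDesignOfOrder Γ v 𝓑

/-- A down-link from `𝓑` to `𝓑'`: a map `f : 𝓑 → 𝓑'` sending each block to a subgraph of it. -/
def IsDownLink {𝓑 𝓑' : Set NatGraph} (f : 𝓑 → 𝓑') : Prop :=
  ∀ B : 𝓑, (f B : NatGraph) ≤ (B : NatGraph)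

/-- `𝓑` can be down-linked to `𝓑'`. -/
def DownLinkable (𝓑 𝓑' : Set NatGraph) : Prop :=
  ∃ f : 𝓑 → 𝓑', IsDownLink f

/-- The orders `n` such that *some* `Γ`-design of order `v` can be down-linked to a `Γ'`-design
of order `n`. -/
def spectrum₁ {W W' : Type} (Γ : SimpleGraph W) (Γ' : SimpleGraph W') (v : ℕ) : Set ℕ :=
  {n | ∃ 𝓑, IsDesignOfOrder Γ v 𝓑 ∧ ∃ 𝓑', IsDesignOfOrder Γ' n 𝓑' ∧ DownLinkable 𝓑 𝓑'}

/-- The orders `n` such that *every* `Γ`-design of order `v` can be down-linked to a `Γ'`-design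
of order `n`. -/
def spectrum₂ {W W' : Type} (Γ : SimpleGraph W) (Γ' : SimpleGraph W') (v : ℕ) : Set ℕ :=
  {n | ∀ 𝓑, IsDesignOfOrder Γ v 𝓑 → ∃ 𝓑', IsDesignOfOrder Γ' n 𝓑' ∧ DownLinkable 𝓑 𝓑'}

/-- The path `P_k` with `k` vertices and `k - 1` edges. -/
abbrev P (k : ℕ) : SimpleGraph (Fin k) := SimpleGraph.pathGraph k

end DownLink

namespace DownLink

open Finset

/-! Counting edges gives v ≡ 0, 1 (mod 8) and n ≡ 0, 1 (mod 3) (`IsDesignOfOrder.dvd_choose`). If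
two vertices x, y of K_v were missing from K_n, the block through the edge xy would have only three
vertices left for its image; hence n ≥ v - 1 (`card_sdiff_le_one`).

For existence, delete one end edge from each P_5. The shortened paths are blocks of a P_4-design of
order n, and a down-link results, as soon as the rest of K_n decomposes into P_4's. The central
lemma is `p4Dec_hubs`: a graph on at least two vertices, joined completely to two new adjacent
vertices (hubs), decomposes into P_4's whenever 3 divides its number of edges. For n ≥ v + 2, two
vertices of K_n outside K_v act as hubs, whatever the P_5-design is. For n = v + 1 there is one new
vertex, and the second hub is a vertex of K_v all of whose edges have been deleted
(`rooted_of_card`). For n = v the rest consists of the deleted edges, which must themselves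
decompose (`completeSplit_of_card`). For n = v - 1 all edges at one vertex are deleted, and the
other deleted edges must decompose (`rootedSplit_of_card`). These special designs grow by 8 or 24
vertices at a time: two complete graphs sharing at most one vertex are completed by the bipartite
graph between them. The small ingredients are explicit and checked by computation.

Finally, v - 1 is not in the second spectrum: some P_5-design has every vertex in the interior of a
block (`allInterior_of_card`), and a P_5 without an interior vertex contains no P_4
(`mem_verts_of_interior`). -/

/-! ### Edge sets, P_4-decompositions and P_5-decompositions with marked end edges -/

/-- The edges traversed by a walk given by its list of vertices. -/
def trail : List ℕ → List (Sym2 ℕ)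
  | a :: b :: l => s(a, b) :: trail (b :: l)
  | _ => []

/-- The edges of the complete graph on `S`. -/
def completeEdges (S : Finset ℕ) : Finset (Sym2 ℕ) := S.sym2.filter fun e => ¬ e.IsDiag

/-- The edges of the star with centre `p` and set of leaves `V`. -/
def cone (p : ℕ) (V : Finset ℕ) : Finset (Sym2 ℕ) := V.image fun a => s(p, a)

/-- The edges of the complete bipartite graph with parts `A` and `B`. -/
def bip (A B : Finset ℕ) : Finset (Sym2 ℕ) := (A ×ˢ B).image fun x => s(x.1, x.2)

/-- `F` is the edge set of a graph that decomposes into paths with four vertices. -/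
inductive P4Dec : Finset (Sym2 ℕ) → Prop
  | empty : P4Dec ∅
  | add (a b c d : ℕ) (F : Finset (Sym2 ℕ)) : [a, b, c, d].Nodup →
      Disjoint (trail [a, b, c, d]).toFinset F → P4Dec F →
      P4Dec ((trail [a, b, c, d]).toFinset ∪ F)

/-- `E` is the edge set of a graph with a decomposition into paths with five vertices such that
`L` is a set of end edges, one from each path, and `I` is the set of interior vertices of the
paths. -/
inductive Marked : Finset (Sym2 ℕ) → Finset (Sym2 ℕ) → Finset ℕ → Prop
  | empty : Marked ∅ ∅ ∅
  | add (a b c d e : ℕ) (E L : Finset (Sym2 ℕ)) (I : Finset ℕ) : [a, b, c, d, e].Nodup →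
      Disjoint (trail [a, b, c, d, e]).toFinset E → Marked E L I →
      Marked ((trail [a, b, c, d, e]).toFinset ∪ E) (insert s(a, b) L) ({b, c, d} ∪ I)

theorem mk_mem_completeEdges {S : Finset ℕ} {x y : ℕ} :
    s(x, y) ∈ completeEdges S ↔ x ∈ S ∧ y ∈ S ∧ x ≠ y := by
  simp [completeEdges, and_assoc]

theorem mk_mem_cone {V : Finset ℕ} {p x y : ℕ} :
    s(x, y) ∈ cone p V ↔ x = p ∧ y ∈ V ∨ y = p ∧ x ∈ V := by
  simp only [cone, mem_image, Sym2.eq_iff]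
  grind

theorem mk_mem_bip {A B : Finset ℕ} {x y : ℕ} :
    s(x, y) ∈ bip A B ↔ x ∈ A ∧ y ∈ B ∨ y ∈ A ∧ x ∈ B := by
  simp only [bip, mem_image, Sym2.eq_iff, mem_product, Prod.exists]
  grind

theorem card_completeEdges (S : Finset ℕ) : (completeEdges S).card = S.card.choose 2 := by
  rw [← Sym2.card_image_offDiag]
  congr 1
  ext e
  induction e with | _ x y
  simp only [mk_mem_completeEdges, mem_image, mem_offDiag, Prod.exists, Function.uncurry_apply_pair,
    Sym2.eq_iff]
  grind

theorem completeEdges_mono {S T : Finset ℕ} (h : S ⊆ T) : completeEdges S ⊆ completeEdges T := by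
  intro e
  induction e with | _ x y
  simp only [mk_mem_completeEdges]
  grind

theorem completeEdges_union_disjoint {A B : Finset ℕ} (h : Disjoint A B) :
    completeEdges (A ∪ B) = completeEdges A ∪ completeEdges B ∪ bip A B := by
  ext e
  induction e with | _ x y
  have := Finset.disjoint_left.1 h
  simp only [mem_union, mk_mem_completeEdges, mk_mem_bip]
  grind

theorem P4Dec.union {F G : Finset (Sym2 ℕ)} (hF : P4Dec F) (hG : P4Dec G) (h : Disjoint F G) :
    P4Dec (F ∪ G) := by
  induction hF with
  | empty => simpa
  | add a b c d F hn hd _ ih =>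
    rw [disjoint_union_left] at h
    rw [union_assoc]
    exact .add a b c d _ hn (disjoint_union_right.2 ⟨hd, h.1⟩) (ih h.2)

theorem Marked.union {E E' L L' : Finset (Sym2 ℕ)} {I I' : Finset ℕ} (h₁ : Marked E L I)
    (h₂ : Marked E' L' I') (h : Disjoint E E') : Marked (E ∪ E') (L ∪ L') (I ∪ I') := by
  induction h₁ with
  | empty => simpa
  | add a b c d e E L I hn hd _ ih =>
    rw [disjoint_union_left] at h
    rw [union_assoc, union_assoc, insert_union]
    exact .add a b c d e _ _ _ hn (disjoint_union_right.2 ⟨hd, h.1⟩) (ih h.2)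

theorem Marked.subset {E L : Finset (Sym2 ℕ)} {I : Finset ℕ} (h : Marked E L I) : L ⊆ E := by
  induction h with
  | empty => simp
  | add a b c d e E L I hn hd _ ih =>
    refine insert_subset (by simp [trail]) (ih.trans subset_union_right)

/-! ### Relabelling vertices, and decompositions given by lists -/

theorem trail_map (g : ℕ → ℕ) (l : List ℕ) : trail (l.map g) = (trail l).map (Sym2.map g) := by
  induction l with
  | nil => rfl
  | cons a l ih =>
    cases l with
    | nil => rfl
    | cons b l => simpa [trail] using ih

theorem toFinset_trail_map (g : ℕ → ℕ) (l : List ℕ) :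
    (trail (l.map g)).toFinset = (trail l).toFinset.image (Sym2.map g) := by
  rw [trail_map]
  ext
  simp

theorem P4Dec.map {F : Finset (Sym2 ℕ)} (hF : P4Dec F) (g : Equiv.Perm ℕ) :
    P4Dec (F.image (Sym2.map g)) := by
  induction hF with
  | empty => exact .empty
  | add a b c d F hn hd _ ih =>
    have := P4Dec.add (g a) (g b) (g c) (g d) (F.image (Sym2.map g)) (hn.map g.injective)
    rw [show [g a, g b, g c, g d] = [a, b, c, d].map g from rfl, toFinset_trail_map] at this
    rw [image_union]
    exact this ((disjoint_image (Sym2.map.injective g.injective)).2 hd) ih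

theorem Marked.map {E L : Finset (Sym2 ℕ)} {I : Finset ℕ} (h : Marked E L I) (g : Equiv.Perm ℕ) :
    Marked (E.image (Sym2.map g)) (L.image (Sym2.map g)) (I.image g) := by
  induction h with
  | empty => exact .empty
  | add a b c d e E L I hn hd _ ih =>
    have := Marked.add (g a) (g b) (g c) (g d) (g e) (E.image (Sym2.map g)) (L.image (Sym2.map g))
      (I.image g) (hn.map g.injective)
    rw [show [g a, g b, g c, g d, g e] = [a, b, c, d, e].map g from rfl, toFinset_trail_map] at this
    simp only [image_union, image_insert, image_singleton]
    exact this ((disjoint_image (Sym2.map.injective g.injective)).2 hd) ih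

theorem completeEdges_image (g : Equiv.Perm ℕ) (S : Finset ℕ) :
    (completeEdges S).image (Sym2.map g) = completeEdges (S.image g) := by
  ext e
  induction e with | _ x y
  obtain ⟨x, rfl⟩ := g.surjective x
  obtain ⟨y, rfl⟩ := g.surjective y
  rw [← Sym2.map_mk, (Sym2.map.injective g.injective).mem_finset_image, Sym2.map_mk]
  simp [mk_mem_completeEdges]

theorem cone_image (g : Equiv.Perm ℕ) (p : ℕ) (V : Finset ℕ) :
    (cone p V).image (Sym2.map g) = cone (g p) (V.image g) := by
  simp [cone, image_image, Function.comp_def]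

theorem bip_image (g : Equiv.Perm ℕ) (A B : Finset ℕ) :
    (bip A B).image (Sym2.map g) = bip (A.image g) (B.image g) := by
  ext e
  induction e with | _ x y
  obtain ⟨x, rfl⟩ := g.surjective x
  obtain ⟨y, rfl⟩ := g.surjective y
  rw [← Sym2.map_mk, (Sym2.map.injective g.injective).mem_finset_image, Sym2.map_mk]
  simp [mk_mem_bip]

theorem P4Dec.of_list (ls : List (List ℕ)) (h : ∀ l ∈ ls, l.length = 4 ∧ l.Nodup)
    (hd : (ls.flatMap trail).Nodup) : P4Dec (ls.flatMap trail).toFinset := by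
  induction ls with
  | nil => exact .empty
  | cons l ls ih =>
    simp only [List.mem_cons, forall_eq_or_imp] at h
    obtain ⟨⟨hl, hn⟩, h⟩ := h
    obtain ⟨a, b, c, d, rfl⟩ := List.length_eq_four.1 hl
    rw [List.flatMap_cons] at hd ⊢
    rw [List.toFinset_append]
    exact .add a b c d _ hn (List.disjoint_toFinset_iff_disjoint.2 (List.disjoint_of_nodup_append hd))
      (ih h hd.of_append_right)

theorem Marked.of_list (ls : List (List ℕ)) (h : ∀ l ∈ ls, l.length = 5 ∧ l.Nodup)
    (hd : (ls.flatMap trail).Nodup) :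
    Marked (ls.flatMap trail).toFinset (ls.flatMap fun l => (trail l).take 1).toFinset
      (ls.flatMap fun l => l.tail.dropLast).toFinset := by
  induction ls with
  | nil => exact .empty
  | cons l ls ih =>
    simp only [List.mem_cons, forall_eq_or_imp] at h
    obtain ⟨⟨hl, hn⟩, h⟩ := h
    obtain ⟨a, b, c, d, e, rfl⟩ : ∃ a b c d e, l = [a, b, c, d, e] := by
      match l, hl with
      | [a, b, c, d, e], _ => exact ⟨a, b, c, d, e, rfl⟩
    rw [List.flatMap_cons] at hd
    have := Marked.add a b c d e _ _ _ hn
      (List.disjoint_toFinset_iff_disjoint.2 (List.disjoint_of_nodup_append hd))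
      (ih h hd.of_append_right)
    simp only [List.flatMap_cons, List.toFinset_append]
    convert this using 1
    · ext; simp [trail]
    · ext; simp

/-- Any list of distinct numbers is the image of an initial segment under a permutation. -/
theorem exists_perm_map_range (l : List ℕ) (hl : l.Nodup) :
    ∃ g : Equiv.Perm ℕ, (List.range l.length).map g = l := by
  obtain ⟨g, hg⟩ := Equiv.Perm.exists_extending_pair (fun i : Fin l.length => (i : ℕ)) l.get
    Fin.val_injective (List.nodup_iff_injective_get.1 hl)
  refine ⟨g, List.ext_getElem (by simp) fun i h₁ h₂ => ?_⟩
  simpa using hg ⟨i, h₂⟩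

/-! ### The required kinds of decomposition and their invariance under relabelling -/

/-- The complete graph on `insert x V` has a decomposition into paths with five vertices, all of
whose edges at `x` are marked. -/
def Rooted (x : ℕ) (V : Finset ℕ) : Prop :=
  ∃ L I, Marked (completeEdges (insert x V)) L I ∧ cone x V ⊆ L

/-- The complete graph on `insert x V` has a decomposition into paths with five vertices, all of
whose edges at `x` are marked, such that the other marked edges form a graph that decomposes into
paths with four vertices. -/
def RootedSplit (x : ℕ) (V : Finset ℕ) : Prop :=
  ∃ L I, Marked (completeEdges (insert x V)) (cone x V ∪ L) I ∧ L ⊆ completeEdges V ∧ P4Dec L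

/-- The complete graph on `V` has a decomposition into paths with five vertices such that the
marked edges form a graph that decomposes into paths with four vertices. -/
def CompleteSplit (V : Finset ℕ) : Prop :=
  ∃ L I, Marked (completeEdges V) L I ∧ P4Dec L

/-- The complete graph on `V` has a decomposition into paths with five vertices such that each
vertex is an interior vertex of one of the paths. -/
def AllInterior (V : Finset ℕ) : Prop :=
  ∃ L I, Marked (completeEdges V) L I ∧ V ⊆ I

/-- The complete bipartite graph with parts `A` and `B` decomposes into paths with five
vertices. -/
def BipDec (A B : Finset ℕ) : Prop :=
  ∃ L I, Marked (bip A B) L I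

/-- The complete bipartite graph with parts `A` and `B` has a decomposition into paths with five
vertices such that the marked edges form a graph that decomposes into paths with four vertices. -/
def BipSplit (A B : Finset ℕ) : Prop :=
  ∃ L I, Marked (bip A B) L I ∧ P4Dec L

/-- A permutation that takes two consecutive intervals to two given disjoint sets. -/
theorem exists_perm_image (A B : Finset ℕ) (h : Disjoint A B) :
    ∃ g : Equiv.Perm ℕ, (range A.card).image g = A ∧
      (Ico A.card (A.card + B.card)).image g = B := by
  obtain ⟨g, hg⟩ := exists_perm_map_range (A.toList ++ B.toList) (by
    simpa [List.nodup_append, A.nodup_toList, B.nodup_toList] using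
      fun a ha b hb => disjoint_iff_ne.1 h a ha b hb)
  have hl : (A.toList ++ B.toList).length = A.card + B.card := by simp
  rw [hl, List.range_add, List.map_append] at hg
  obtain ⟨h₁, h₂⟩ := List.append_inj hg (by simp)
  refine ⟨g, ?_, ?_⟩
  · ext y
    rw [← mem_toList (s := A), ← h₁]
    simp
  · ext y
    rw [← mem_toList (s := B), ← h₂]
    simp only [mem_image, mem_Ico, List.map_map, List.mem_map, List.mem_range, Function.comp]
    constructor
    · rintro ⟨a, ha, rfl⟩
      exact ⟨a - A.card, by omega, by congr 1; omega⟩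
    · rintro ⟨a, ha, rfl⟩
      exact ⟨A.card + a, by omega, rfl⟩

theorem exists_perm_root {x n : ℕ} {V : Finset ℕ} (hx : x ∉ V) (hV : V.card = n) :
    ∃ g : Equiv.Perm ℕ, g 0 = x ∧ (Ico 1 (n + 1)).image g = V := by
  obtain ⟨g, h₁, h₂⟩ := exists_perm_image {x} V (by simpa)
  refine ⟨g, by simpa using h₁, ?_⟩
  rwa [card_singleton, hV, add_comm] at h₂

theorem exists_perm_range {n : ℕ} {V : Finset ℕ} (hV : V.card = n) :
    ∃ g : Equiv.Perm ℕ, (range n).image g = V := by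
  obtain ⟨g, h, -⟩ := exists_perm_image V ∅ (by simp)
  exact ⟨g, by rwa [hV] at h⟩

/-- Permuting the vertices reduces each small order to a single decomposition on an initial segment,
with the root at 0. -/
theorem Rooted.of_base {x n : ℕ} {V : Finset ℕ} (h : Rooted 0 (Ico 1 (n + 1))) (hx : x ∉ V)
    (hV : V.card = n) : Rooted x V := by
  obtain ⟨g, rfl, rfl⟩ := exists_perm_root hx hV
  obtain ⟨L, I, hM, hL⟩ := h
  refine ⟨L.image (Sym2.map g), I.image g, ?_, ?_⟩
  · simpa only [completeEdges_image, image_insert] using hM.map g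
  · simpa only [cone_image] using image_subset_image (f := Sym2.map g) hL

theorem RootedSplit.of_base {x n : ℕ} {V : Finset ℕ} (h : RootedSplit 0 (Ico 1 (n + 1)))
    (hx : x ∉ V) (hV : V.card = n) : RootedSplit x V := by
  obtain ⟨g, rfl, rfl⟩ := exists_perm_root hx hV
  obtain ⟨L, I, hM, hL, hP⟩ := h
  refine ⟨L.image (Sym2.map g), I.image g, ?_, ?_, hP.map g⟩
  · simpa only [completeEdges_image, image_insert, image_union, cone_image] using hM.map g
  · simpa only [completeEdges_image] using image_subset_image (f := Sym2.map g) hL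

theorem CompleteSplit.of_base {n : ℕ} {V : Finset ℕ} (h : CompleteSplit (range n))
    (hV : V.card = n) : CompleteSplit V := by
  obtain ⟨g, rfl⟩ := exists_perm_range hV
  obtain ⟨L, I, hM, hP⟩ := h
  exact ⟨_, _, by simpa only [completeEdges_image] using hM.map g, hP.map g⟩

theorem AllInterior.of_base {n : ℕ} {V : Finset ℕ} (h : AllInterior (range n))
    (hV : V.card = n) : AllInterior V := by
  obtain ⟨g, rfl⟩ := exists_perm_range hV
  obtain ⟨L, I, hM, hI⟩ := h
  exact ⟨_, _, by simpa only [completeEdges_image] using hM.map g, image_subset_image hI⟩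

theorem BipDec.of_base {a b : ℕ} {A B : Finset ℕ} (h : BipDec (range a) (Ico a (a + b)))
    (hAB : Disjoint A B) (hA : A.card = a) (hB : B.card = b) : BipDec A B := by
  obtain ⟨g, h₁, h₂⟩ := exists_perm_image A B hAB
  obtain ⟨L, I, hM⟩ := h
  subst hA hB
  refine ⟨L.image (Sym2.map g), I.image g, ?_⟩
  simpa only [bip_image, h₁, h₂] using hM.map g

theorem BipSplit.of_base {a b : ℕ} {A B : Finset ℕ} (h : BipSplit (range a) (Ico a (a + b)))
    (hAB : Disjoint A B) (hA : A.card = a) (hB : B.card = b) : BipSplit A B := by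
  obtain ⟨g, h₁, h₂⟩ := exists_perm_image A B hAB
  obtain ⟨L, I, hM, hP⟩ := h
  subst hA hB
  refine ⟨L.image (Sym2.map g), I.image g, ?_, hP.map g⟩
  simpa only [bip_image, h₁, h₂] using hM.map g

/-! ### Verification of explicit decompositions by bit masks -/

/-- A numbering of the unordered pairs of natural numbers. -/
def pairCode (e : Sym2 ℕ) : ℕ :=
  e.lift ⟨fun a b => max a b ^ 2 + min a b, fun a b => by simp only [max_comm, min_comm]⟩

/-- With m the maximum, the code lies between m² and m² + m < (m + 1)², so it determines m and then
the minimum. -/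
theorem pairCode_injective : Function.Injective pairCode := by
  have key (a b c d : ℕ) (hab : a ≤ b) (hcd : c ≤ d) (h : b ^ 2 + a = d ^ 2 + c) : b ≤ d := by
    by_contra! hlt
    nlinarith
  have key' (a b c d : ℕ) (hab : a ≤ b) (hcd : c ≤ d) (h : b ^ 2 + a = d ^ 2 + c) :
      a = c ∧ b = d := by
    obtain rfl : b = d := le_antisymm (key _ _ _ _ hab hcd h) (key _ _ _ _ hcd hab h.symm)
    exact ⟨by omega, rfl⟩
  intro e f h
  induction e with | _ a b
  induction f with | _ c d
  have h' : max a b ^ 2 + min a b = max c d ^ 2 + min c d := h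
  have := key' _ _ _ _ (min_le_max) (min_le_max) h'
  rw [Sym2.eq_iff]
  omega

/-- The number whose binary digits indicate which pairs occur in a list. -/
def pairMask : List (Sym2 ℕ) → ℕ
  | [] => 0
  | e :: l => 1 <<< pairCode e ||| pairMask l

/-- A fast test that a list has no duplicates and avoids the pairs recorded in a number. -/
def freshPairs : ℕ → List (Sym2 ℕ) → Bool
  | _, [] => true
  | m, e :: l => !m.testBit (pairCode e) && freshPairs (m ||| 1 <<< pairCode e) l

theorem testBit_pairMask (l : List (Sym2 ℕ)) (e : Sym2 ℕ) :
    (pairMask l).testBit (pairCode e) = true ↔ e ∈ l := by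
  induction l with
  | nil => simp [pairMask]
  | cons f l ih =>
    rw [pairMask, Nat.testBit_or, Bool.or_eq_true, ih, Nat.one_shiftLeft, Nat.testBit_two_pow,
      decide_eq_true_eq, pairCode_injective.eq_iff, List.mem_cons, eq_comm]

/-- Turns equality of edge sets into equality of two numerals, which is cheap to evaluate. -/
theorem toFinset_eq_of_pairMask {l l' : List (Sym2 ℕ)} (h : pairMask l = pairMask l') :
    l.toFinset = l'.toFinset := by
  ext e
  rw [List.mem_toFinset, List.mem_toFinset, ← testBit_pairMask, h, testBit_pairMask]

/-- Inclusion is tested as absorption in a union. -/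
theorem toFinset_subset_of_pairMask {l l' : List (Sym2 ℕ)}
    (h : pairMask (l ++ l') = pairMask l') : l.toFinset ⊆ l'.toFinset := by
  rw [← toFinset_eq_of_pairMask h, List.toFinset_append]
  exact subset_union_left

/-- The mask `m` records the pairs already seen, so the induction must carry avoidance of `m` along
with distinctness. -/
theorem nodup_of_freshPairs {m : ℕ} {l : List (Sym2 ℕ)} (h : freshPairs m l = true) :
    l.Nodup ∧ ∀ e ∈ l, m.testBit (pairCode e) = false := by
  induction l generalizing m with
  | nil => simp
  | cons f l ih =>
    rw [freshPairs, Bool.and_eq_true, Bool.not_eq_true'] at h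
    obtain ⟨h₁, h₂⟩ := ih h.2
    simp only [Nat.testBit_or, Bool.or_eq_false_iff, Nat.one_shiftLeft, Nat.testBit_two_pow,
      decide_eq_false_iff_not, pairCode_injective.eq_iff] at h₂
    refine ⟨List.nodup_cons.2 ⟨fun hf => (h₂ f hf).2 rfl, h₁⟩, ?_⟩
    simp only [List.mem_cons, forall_eq_or_imp]
    exact ⟨h.1, fun e he => (h₂ e he).1⟩

/-- The pairs of distinct members of a list. -/
def completeList (l : List ℕ) : List (Sym2 ℕ) :=
  l.flatMap fun a => l.flatMap fun b => if a = b then [] else [s(a, b)]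

/-- The pairs with one member in each of two lists. -/
def bipList (l l' : List ℕ) : List (Sym2 ℕ) :=
  l.flatMap fun a => l'.map fun b => s(a, b)

theorem completeList_toFinset (l : List ℕ) :
    (completeList l).toFinset = completeEdges l.toFinset := by
  ext e
  induction e with | _ x y
  simp only [completeList, List.mem_toFinset, List.mem_flatMap, mk_mem_completeEdges]
  constructor
  · rintro ⟨a, ha, b, hb, h⟩
    split_ifs at h <;> simp at h
    grind
  · rintro ⟨hx, hy, h⟩
    exact ⟨x, hx, y, hy, by simp [h]⟩

theorem bipList_toFinset (l l' : List ℕ) :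
    (bipList l l').toFinset = bip l.toFinset l'.toFinset := by
  ext e
  simp [bipList, bip, and_assoc]

theorem range_eq_toFinset (n : ℕ) : range n = (List.range n).toFinset := by
  ext; simp

theorem Ico_eq_toFinset (m n : ℕ) : Ico m (m + n) = (List.range' m n).toFinset := by
  ext; simp

theorem completeEdges_range (n : ℕ) :
    completeEdges (range n) = (completeList (List.range n)).toFinset := by
  rw [completeList_toFinset, range_eq_toFinset]

theorem completeEdges_Ico (n : ℕ) :
    completeEdges (Ico 1 (n + 1)) = (completeList (List.range' 1 n)).toFinset := by
  rw [completeList_toFinset, add_comm, Ico_eq_toFinset]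

theorem completeEdges_insert_Ico (n : ℕ) :
    completeEdges (insert 0 (Ico 1 (n + 1))) = (completeList (List.range (n + 1))).toFinset := by
  rw [← completeEdges_range]
  congr 1
  ext
  simp
  omega

theorem cone_Ico (n : ℕ) :
    cone 0 (Ico 1 (n + 1)) = ((List.range' 1 n).map fun a => s(0, a)).toFinset := by
  ext
  rw [add_comm, cone, Ico_eq_toFinset]
  simp

theorem bip_range_Ico (a b : ℕ) :
    bip (range a) (Ico a (a + b)) = (bipList (List.range a) (List.range' a b)).toFinset := by
  rw [bipList_toFinset, range_eq_toFinset, Ico_eq_toFinset]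

/-- A fast test that the given paths with `k` vertices decompose the graph whose edges are the
members of a given list. -/
def checkPaths (k : ℕ) (ls : List (List ℕ)) (E : List (Sym2 ℕ)) : Bool :=
  decide (∀ l ∈ ls, l.length = k ∧ l.Nodup) && freshPairs 0 (ls.flatMap trail) &&
    decide (pairMask (ls.flatMap trail) = pairMask E)

/-- The initial edges of the given paths. -/
def initialEdges (ls : List (List ℕ)) : List (Sym2 ℕ) := ls.flatMap fun l => (trail l).take 1

theorem Marked.of_check {ls : List (List ℕ)} {E : List (Sym2 ℕ)}
    (h : checkPaths 5 ls E = true) :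
    Marked E.toFinset (initialEdges ls).toFinset
      (ls.flatMap fun l => l.tail.dropLast).toFinset := by
  rw [checkPaths, Bool.and_eq_true, Bool.and_eq_true, decide_eq_true_eq, decide_eq_true_eq] at h
  rw [← toFinset_eq_of_pairMask h.2]
  exact .of_list ls h.1.1 (nodup_of_freshPairs h.1.2).1

theorem P4Dec.of_check {ls : List (List ℕ)} {F : List (Sym2 ℕ)}
    (h : checkPaths 4 ls F = true) : P4Dec F.toFinset := by
  rw [checkPaths, Bool.and_eq_true, Bool.and_eq_true, decide_eq_true_eq, decide_eq_true_eq] at h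
  rw [← toFinset_eq_of_pairMask h.2]
  exact .of_list ls h.1.1 (nodup_of_freshPairs h.1.2).1

theorem Rooted.of_check {x n : ℕ} {V : Finset ℕ} (hx : x ∉ V) (hV : V.card = n)
    (ls : List (List ℕ)) (h₁ : checkPaths 5 ls (completeList (List.range (n + 1))) = true)
    (h₂ : pairMask (((List.range' 1 n).map fun a => s(0, a)) ++ initialEdges ls) =
      pairMask (initialEdges ls)) : Rooted x V := by
  refine .of_base ⟨(initialEdges ls).toFinset, (ls.flatMap fun l => l.tail.dropLast).toFinset,
    ?_, ?_⟩ hx hV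
  · rw [completeEdges_insert_Ico]
    exact .of_check h₁
  · rw [cone_Ico]
    exact toFinset_subset_of_pairMask h₂

theorem RootedSplit.of_check {x n : ℕ} {V : Finset ℕ} (hx : x ∉ V) (hV : V.card = n)
    (ls ls' : List (List ℕ)) (L : List (Sym2 ℕ))
    (h₁ : checkPaths 5 ls (completeList (List.range (n + 1))) = true)
    (h₂ : pairMask (initialEdges ls) = pairMask (((List.range' 1 n).map fun a => s(0, a)) ++ L))
    (h₃ : pairMask (L ++ completeList (List.range' 1 n)) =
      pairMask (completeList (List.range' 1 n)))
    (h₄ : checkPaths 4 ls' L = true) : RootedSplit x V := by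
  refine .of_base ⟨L.toFinset, (ls.flatMap fun l => l.tail.dropLast).toFinset, ?_, ?_,
    .of_check h₄⟩ hx hV
  · rw [completeEdges_insert_Ico, cone_Ico, ← List.toFinset_append, ← toFinset_eq_of_pairMask h₂]
    exact .of_check h₁
  · rw [completeEdges_Ico]
    exact toFinset_subset_of_pairMask h₃

theorem CompleteSplit.of_check {n : ℕ} {V : Finset ℕ} (hV : V.card = n) (ls ls' : List (List ℕ))
    (h₁ : checkPaths 5 ls (completeList (List.range n)) = true)
    (h₂ : checkPaths 4 ls' (initialEdges ls) = true) : CompleteSplit V :=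
  .of_base ⟨_, _, by rw [completeEdges_range]; exact .of_check h₁, .of_check h₂⟩ hV

theorem AllInterior.of_check {n : ℕ} {V : Finset ℕ} (hV : V.card = n) (ls : List (List ℕ))
    (h₁ : checkPaths 5 ls (completeList (List.range n)) = true)
    (h₂ : ∀ a ∈ List.range n, a ∈ ls.flatMap fun l => l.tail.dropLast) : AllInterior V :=
  .of_base ⟨_, _, by rw [completeEdges_range]; exact .of_check h₁, by
    rw [range_eq_toFinset]
    exact fun a ha => by simpa using h₂ a (by simpa using ha)⟩ hV

theorem BipDec.of_check {a b : ℕ} {A B : Finset ℕ} (h : Disjoint A B) (hA : A.card = a)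
    (hB : B.card = b) (ls : List (List ℕ))
    (h₁ : checkPaths 5 ls (bipList (List.range a) (List.range' a b)) = true) : BipDec A B :=
  .of_base ⟨_, _, by rw [bip_range_Ico]; exact .of_check h₁⟩ h hA hB

theorem BipSplit.of_check {a b : ℕ} {A B : Finset ℕ} (h : Disjoint A B) (hA : A.card = a)
    (hB : B.card = b) (ls ls' : List (List ℕ))
    (h₁ : checkPaths 5 ls (bipList (List.range a) (List.range' a b)) = true)
    (h₂ : checkPaths 4 ls' (initialEdges ls) = true) : BipSplit A B :=
  .of_base ⟨_, _, by rw [bip_range_Ico]; exact .of_check h₁, .of_check h₂⟩ h hA hB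

/-! ### Explicit small decompositions -/

/-- Paths with five vertices that decompose `K_9`, all starting at `0` where they meet it. -/
def rootedPaths9 : List (List ℕ) :=
  [[0, 4, 5, 2, 6], [0, 5, 3, 8, 7], [0, 1, 5, 8, 2], [0, 3, 1, 4, 6], [0, 6, 8, 1, 7], [0, 8, 4,
   3, 2], [0, 7, 6, 1, 2], [0, 2, 7, 5, 6], [2, 4, 7, 3, 6]]

theorem rooted_eight {x : ℕ} {V : Finset ℕ} (hx : x ∉ V) (hV : V.card = 8) : Rooted x V :=
  .of_check hx hV rootedPaths9 (by decide +kernel) (by decide +kernel)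

/-- Paths with five vertices that decompose `K_{2,4}`. -/
def bipPaths24 : List (List ℕ) :=
  [[2, 1, 5, 0, 4], [2, 0, 3, 1, 4]]

theorem bipDec_two_four {A B : Finset ℕ} (h : Disjoint A B) (hA : A.card = 2) (hB : B.card = 4) :
    BipDec A B :=
  .of_check h hA hB bipPaths24 (by decide +kernel)

/-- Paths with five vertices that decompose `K_{3,4}`. -/
def bipPaths34 : List (List ℕ) :=
  [[3, 0, 5, 2, 6], [5, 1, 4, 0, 6], [4, 2, 3, 1, 6]]

theorem bipDec_three_four {A B : Finset ℕ} (h : Disjoint A B) (hA : A.card = 3) (hB : B.card = 4) :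
    BipDec A B :=
  .of_check h hA hB bipPaths34 (by decide +kernel)

/-- Paths with five vertices that decompose `K_{4,6}`. -/
def splitPaths46 : List (List ℕ) :=
  [[3, 6, 2, 8, 0], [4, 3, 8, 1, 5], [1, 6, 0, 7, 3], [1, 9, 0, 5, 3], [0, 4, 2, 9, 3], [4, 1, 7,
   2, 5]]

/-- Paths with four vertices that decompose the initial edges of `splitPaths46`. -/
def splitLinks46 : List (List ℕ) :=
  [[1, 6, 3, 4], [0, 4, 1, 9]]

theorem bipSplit_four_six {A B : Finset ℕ} (h : Disjoint A B) (hA : A.card = 4)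
    (hB : B.card = 6) : BipSplit A B :=
  .of_check h hA hB splitPaths46 splitLinks46 (by decide +kernel) (by decide +kernel)

/-- Paths with five vertices that decompose `K_{3,8}`. -/
def splitPaths38 : List (List ℕ) :=
  [[3, 1, 9, 2, 4], [4, 1, 8, 0, 10], [10, 1, 6, 2, 7], [4, 0, 7, 1, 5], [8, 2, 5, 0, 6], [10, 2,
   3, 0, 9]]

/-- Paths with four vertices that decompose the initial edges of `splitPaths38`. -/
def splitLinks38 : List (List ℕ) :=
  [[0, 4, 1, 3], [1, 10, 2, 8]]

theorem bipSplit_three_eight {A B : Finset ℕ} (h : Disjoint A B) (hA : A.card = 3)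
    (hB : B.card = 8) : BipSplit A B :=
  .of_check h hA hB splitPaths38 splitLinks38 (by decide +kernel) (by decide +kernel)

/-- Paths with five vertices that decompose `K_8`, all starting at `0` where they meet it. -/
def rootedPaths8 : List (List ℕ) :=
  (List.range 7).map fun i => [0, i + 1, (i + 1) % 7 + 1, (i + 6) % 7 + 1, (i + 2) % 7 + 1]

/-- Paths with four vertices that decompose the initial edges of `rootedPaths8` not at `0`. -/
def rootedLinks8 : List (List ℕ) :=
  []

/-- The paths are the rotations of a zigzag on the integers mod 7 with differences 1, 2, 3, preceded
by an edge from the fixed vertex 0. Only edges at 0 are initial, so no links are needed. -/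
theorem rootedSplit_seven {x : ℕ} {V : Finset ℕ} (hx : x ∉ V) (hV : V.card = 7) :
    RootedSplit x V :=
  .of_check hx hV rootedPaths8 rootedLinks8 (rootedLinks8.flatMap trail) (by decide +kernel) (by decide +kernel) (by decide +kernel)
    (by decide +kernel)

theorem rooted_seven {x : ℕ} {V : Finset ℕ} (hx : x ∉ V) (hV : V.card = 7) : Rooted x V := by
  obtain ⟨L, I, h, -, -⟩ := rootedSplit_seven hx hV
  exact ⟨_, I, h, subset_union_left⟩

/-- Paths with five vertices that decompose `K_16`, all starting at `0` where they meet it. -/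
def rootedPaths16 : List (List ℕ) :=
  (List.range 15).flatMap fun i =>
    [[0, i + 1, (i + 1) % 15 + 1, (i + 14) % 15 + 1, (i + 2) % 15 + 1],
      [i + 1, (i + 4) % 15 + 1, (i + 14) % 15 + 1, (i + 5) % 15 + 1, (i + 13) % 15 + 1]]

/-- Paths with four vertices that decompose the initial edges of `rootedPaths16` not at `0`. -/
def rootedLinks16 : List (List ℕ) :=
  (List.range 5).map fun i =>
    [12 * i % 15 + 1, (12 * i + 4) % 15 + 1, (12 * i + 8) % 15 + 1, (12 * i + 12) % 15 + 1]

/-- Two base paths are rotated mod 15: one uses the fixed vertex 0 and the differences 1, 2, 3, the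
other 4, 5, 6, 7. The initial edges not at 0 have difference 4 and form a 15-cycle, which is cut
into five paths. -/
theorem rootedSplit_fifteen {x : ℕ} {V : Finset ℕ} (hx : x ∉ V) (hV : V.card = 15) :
    RootedSplit x V :=
  .of_check hx hV rootedPaths16 rootedLinks16 (rootedLinks16.flatMap trail) (by decide +kernel) (by decide +kernel) (by decide +kernel)
    (by decide +kernel)

/-- Paths with five vertices that decompose `K_17`, all starting at `0` where they meet it. -/
def rootedPaths17 : List (List ℕ) :=
  [[0, 14, 9, 16, 2], [0, 15, 9, 5, 16], [0, 10, 15, 1, 6], [0, 4, 7, 3, 1], [0, 5, 7, 11, 13],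
   [0, 6, 9, 12, 7], [0, 16, 4, 6, 7], [0, 8, 16, 11, 14], [0, 12, 11, 2, 10], [0, 9, 7, 8, 10],
   [0, 3, 2, 13, 8], [0, 2, 12, 16, 10], [0, 11, 9, 13, 5], [0, 1, 5, 15, 16], [0, 7, 1, 16, 14],
   [0, 13, 3, 4, 10], [16, 7, 14, 1, 8], [12, 3, 16, 13, 6], [10, 12, 15, 6, 16], [15, 13, 7, 10,
   9], [3, 9, 8, 15, 7], [8, 4, 11, 1, 9], [12, 8, 14, 13, 1], [10, 13, 12, 1, 2], [13, 4, 5, 10,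
   1], [8, 2, 15, 4, 1], [7, 2, 14, 4, 9], [9, 2, 6, 3, 10], [4, 2, 5, 6, 11], [4, 12, 6, 8, 3],
   [14, 3, 11, 10, 6], [15, 3, 5, 14, 10], [5, 11, 15, 14, 6], [11, 8, 5, 12, 14]]

/-- Paths with four vertices that decompose the initial edges of `rootedPaths17` not at `0`. -/
def rootedLinks17 : List (List ℕ) :=
  [[8, 2, 7, 16], [5, 11, 8, 12], [2, 9, 3, 14], [12, 3, 15, 13], [8, 4, 12, 10], [2, 4, 13, 10]]

theorem rootedSplit_sixteen {x : ℕ} {V : Finset ℕ} (hx : x ∉ V) (hV : V.card = 16) :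
    RootedSplit x V :=
  .of_check hx hV rootedPaths17 rootedLinks17 (rootedLinks17.flatMap trail) (by decide +kernel) (by decide +kernel) (by decide +kernel)
    (by decide +kernel)

/-- Paths with five vertices that decompose `K_25`, all starting at `0` where they meet it. -/
def rootedPaths25 : List (List ℕ) :=
  [[0, 5, 22, 4, 10], [0, 23, 6, 12, 19], [0, 4, 1, 2, 18], [0, 22, 21, 14, 23], [0, 15, 18, 1,
   11], [0, 11, 3, 13, 15], [0, 6, 11, 22, 10], [0, 3, 7, 1, 14], [0, 13, 19, 14, 17], [0, 1, 15,
   5, 9], [0, 9, 18, 10, 1], [0, 8, 24, 16, 10], [0, 20, 13, 24, 7], [0, 19, 16, 17, 6], [0, 10,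
   2, 16, 21], [0, 17, 19, 24, 1], [0, 24, 11, 19, 23], [0, 7, 2, 6, 1], [0, 14, 2, 19, 8], [0,
   18, 11, 12, 10], [0, 12, 21, 3, 22], [0, 2, 20, 16, 3], [0, 16, 12, 3, 23], [0, 21, 15, 9, 7],
   [21, 1, 19, 7, 16], [3, 1, 16, 14, 10], [10, 3, 19, 18, 14], [18, 17, 23, 10, 19], [19, 21, 24,
   10, 5], [9, 21, 11, 15, 19], [16, 5, 21, 10, 15], [7, 20, 10, 11, 8], [22, 8, 2, 11, 16], [15,
   20, 8, 10, 7], [14, 12, 17, 10, 9], [10, 6, 4, 18, 5], [10, 13, 14, 4, 24], [11, 14, 6, 16,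
   13], [12, 7, 15, 6, 19], [6, 5, 4, 15, 16], [9, 12, 8, 14, 15], [21, 23, 8, 16, 18], [20, 22,
   16, 4, 8], [4, 19, 9, 3, 5], [6, 3, 17, 9, 16], [1, 5, 14, 3, 2], [19, 5, 2, 24, 22], [20, 3,
   15, 8, 17], [16, 23, 7, 8, 3], [2, 22, 12, 24, 3], [4, 20, 19, 22, 18], [3, 4, 12, 13, 8], [20,
   24, 23, 18, 3], [2, 9, 14, 24, 6], [14, 22, 9, 24, 15], [21, 13, 18, 24, 5], [15, 12, 1, 22,
   6], [23, 15, 22, 13, 5], [11, 23, 4, 2, 15], [4, 9, 23, 12, 2], [11, 20, 12, 18, 6], [18, 20,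
   23, 5, 12], [13, 23, 22, 7, 4], [23, 2, 13, 17, 7], [23, 1, 9, 13, 4], [8, 1, 13, 11, 4], [21,
   7, 13, 6, 20], [21, 20, 14, 7, 6], [8, 21, 17, 1, 20], [21, 4, 17, 20, 9], [6, 21, 2, 17, 22],
   [9, 6, 8, 18, 21], [15, 17, 5, 7, 18], [20, 5, 11, 17, 24], [5, 8, 9, 11, 7]]

/-- Paths with four vertices that decompose the initial edges of `rootedPaths25` not at `0`. -/
def rootedLinks25 : List (List ℕ) :=
  [[15, 17, 18, 20], [11, 14, 12, 15], [14, 22, 8, 21], [9, 12, 7, 21], [1, 23, 2, 22], [2, 9, 21,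
   23], [15, 23, 11, 20], [8, 5, 16, 23], [1, 21, 13, 23], [8, 1, 5, 19], [4, 3, 10, 13], [1, 3,
   20, 24], [19, 21, 20, 22], [7, 20, 4, 19], [6, 5, 20, 15], [4, 9, 6, 10], [3, 6, 21, 4]]

theorem rootedSplit_twentyFour {x : ℕ} {V : Finset ℕ} (hx : x ∉ V) (hV : V.card = 24) :
    RootedSplit x V :=
  .of_check hx hV rootedPaths25 rootedLinks25 (rootedLinks25.flatMap trail) (by decide +kernel) (by decide +kernel) (by decide +kernel)
    (by decide +kernel)

/-- Paths with five vertices that decompose `K_9`. -/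
def completePaths9 : List (List ℕ) :=
  (List.range 9).map fun i => [i, (i + 1) % 9, (i + 8) % 9, (i + 2) % 9, (i + 7) % 9]

/-- Paths with four vertices that decompose the initial edges of `completePaths9`. -/
def completeLinks9 : List (List ℕ) :=
  (List.range 3).map fun i => [3 * i, 3 * i + 1, 3 * i + 2, (3 * i + 3) % 9]

/-- One zigzag with differences 1, 2, 3, 4 is rotated mod 9. The initial edges form a 9-cycle, which
is cut into three paths. -/
theorem completeSplit_nine {V : Finset ℕ} (hV : V.card = 9) : CompleteSplit V :=
  .of_check hV completePaths9 completeLinks9 (by decide +kernel) (by decide +kernel)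

/-- Paths with five vertices that decompose `K_16`. -/
def completePaths16 : List (List ℕ) :=
  (List.range 15).flatMap fun i =>
    [[(i + 2) % 15, (i + 1) % 15, (i + 3) % 15, i, 15],
      [i, (i + 4) % 15, (i + 14) % 15, (i + 5) % 15, (i + 13) % 15]]

/-- Paths with four vertices that decompose the initial edges of `completePaths16`. -/
def completeLinks16 : List (List ℕ) :=
  (List.range 5).flatMap fun i =>
    [[3 * i, 3 * i + 1, 3 * i + 2, (3 * i + 3) % 15],
      [12 * i % 15, (12 * i + 4) % 15, (12 * i + 8) % 15, (12 * i + 12) % 15]]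

/-- Rotation mod 15 with the fixed vertex 15. The initial edges have differences 1 and 4, giving two
15-cycles, each cut into five paths. -/
theorem completeSplit_sixteen {V : Finset ℕ} (hV : V.card = 16) : CompleteSplit V :=
  .of_check hV completePaths16 completeLinks16 (by decide +kernel) (by decide +kernel)

/-- Paths with five vertices that decompose `K_24`. -/
def completePaths24 : List (List ℕ) :=
  (List.range 23).flatMap fun i =>
    [[(i + 2) % 23, (i + 22) % 23, (i + 1) % 23, i, 23],
      [i, (i + 4) % 23, (i + 22) % 23, (i + 5) % 23, (i + 21) % 23],
      [i, (i + 8) % 23, (i + 22) % 23, (i + 9) % 23, (i + 21) % 23]]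

/-- Paths with four vertices that decompose the initial edges of `completePaths24`. -/
def completeLinks24 : List (List ℕ) :=
  (List.range 23).map fun i => [i, (i + 3) % 23, (i + 22) % 23, (i + 7) % 23]

/-- Rotation mod 23 with the fixed vertex 23. The initial edges have differences 3, 4 and 8, and so
are covered by the rotations of one P_4 with these differences. -/
theorem completeSplit_twentyFour {V : Finset ℕ} (hV : V.card = 24) : CompleteSplit V :=
  .of_check hV completePaths24 completeLinks24 (by decide +kernel) (by decide +kernel)

/-- Paths with five vertices that decompose `K_25`. -/
def completePaths25 : List (List ℕ) :=
  (List.range 25).flatMap fun i =>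
    [[i, (i + 1) % 25, (i + 24) % 25, (i + 2) % 25, (i + 23) % 25],
      [i, (i + 5) % 25, (i + 24) % 25, (i + 6) % 25, (i + 23) % 25],
      [i, (i + 9) % 25, (i + 24) % 25, (i + 10) % 25, (i + 23) % 25]]

/-- Paths with four vertices that decompose the initial edges of `completePaths25`. -/
def completeLinks25 : List (List ℕ) :=
  (List.range 25).map fun i => [i, (i + 1) % 25, (i + 21) % 25, (i + 5) % 25]

/-- Three zigzags rotated mod 25 share out the differences 1 to 12. Their initial differences 1, 5
and 9 are those of a single rotated P_4. -/
theorem completeSplit_twentyFive {V : Finset ℕ} (hV : V.card = 25) : CompleteSplit V :=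
  .of_check hV completePaths25 completeLinks25 (by decide +kernel) (by decide +kernel)

/-- Paths with five vertices that decompose `K_8`. -/
def interiorPaths8 : List (List ℕ) :=
  [[2, 4, 5, 1, 6], [0, 6, 3, 1, 4], [4, 6, 2, 0, 7], [1, 0, 5, 6, 7], [1, 7, 4, 0, 3], [4, 3, 2,
   7, 5], [1, 2, 5, 3, 7]]

theorem allInterior_eight {V : Finset ℕ} (hV : V.card = 8) : AllInterior V :=
  .of_check hV interiorPaths8 (by decide +kernel) (by decide +kernel)

theorem allInterior_nine {V : Finset ℕ} (hV : V.card = 9) : AllInterior V :=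
  .of_check hV completePaths9 (by decide +kernel) (by decide +kernel)

/-! ### Gluing decompositions and growing them to all orders -/

/-- Supports the recursive constructions: a set of size `r + n * k` is built from one of size `r` by
adjoining blocks of size `n`. -/
theorem card_induction {Q : Finset ℕ → Prop} (r n : ℕ) (base : ∀ A, A.card = r → Q A)
    (step : ∀ k A B, Disjoint A B → A.card = r + n * k → B.card = n → Q A → Q (A ∪ B)) (k : ℕ)
    (A : Finset ℕ) (hA : A.card = r + n * k) : Q A := by
  induction k generalizing A with
  | zero => exact base A (by simpa using hA)
  | succ k ih =>
    obtain ⟨B, hB, hc⟩ := exists_subset_card_eq (s := A) (n := n) (by rw [hA, mul_add_one]; omega)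
    have hd : (A \ B).card = r + n * k := by
      rw [card_sdiff_of_subset hB, hA, hc, mul_add_one]
      omega
    simpa [sdiff_union_of_subset hB] using step k _ B sdiff_disjoint hd hc (ih _ hd)

theorem bip_union_left (A A' B : Finset ℕ) : bip (A ∪ A') B = bip A B ∪ bip A' B := by
  simp [bip, union_product, image_union]

theorem bip_comm (A B : Finset ℕ) : bip A B = bip B A := by
  ext e
  induction e with | _ x y
  simp only [mk_mem_bip]
  grind

theorem disjoint_bip {A A' B : Finset ℕ} (h : Disjoint A A') (h₁ : Disjoint A B) :
    Disjoint (bip A B) (bip A' B) := by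
  rw [Finset.disjoint_left] at h h₁ ⊢
  intro e
  induction e with | _ x y
  simp only [mk_mem_bip]
  grind

theorem completeEdges_glue {x : ℕ} {V G : Finset ℕ} (hV : x ∉ V)
    (h : Disjoint V G) : completeEdges (insert x (V ∪ G)) =
      completeEdges (insert x V) ∪ completeEdges (insert x G) ∪ bip V G := by
  ext e
  induction e with | _ a b
  have := Finset.disjoint_left.1 h
  simp only [mem_union, mk_mem_completeEdges, mk_mem_bip, mem_insert]
  grind

theorem disjoint_completeEdges {A B : Finset ℕ} (h : (A ∩ B).card ≤ 1) :
    Disjoint (completeEdges A) (completeEdges B) := by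
  rw [Finset.disjoint_left]
  intro e
  induction e with | _ a b
  rw [card_le_one] at h
  simp only [mk_mem_completeEdges]
  intro h₁ h₂
  exact h₁.2.2 (h a (by simp [h₁, h₂]) b (by simp [h₁, h₂]))

theorem disjoint_completeEdges_insert {x : ℕ} {V G : Finset ℕ} (h : Disjoint V G) :
    Disjoint (completeEdges (insert x V)) (completeEdges (insert x G)) := by
  refine disjoint_completeEdges (card_le_one.2 ?_)
  have := Finset.disjoint_left.1 h
  grind

theorem disjoint_completeEdges_bip {S A B : Finset ℕ} (h : Disjoint S A) :
    Disjoint (completeEdges S) (bip A B) := by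
  rw [Finset.disjoint_left] at h ⊢
  intro e
  induction e with | _ a b
  simp only [mk_mem_completeEdges, mk_mem_bip]
  grind

theorem disjoint_glue_bip {x : ℕ} {V G : Finset ℕ} (hV : x ∉ V) (hG : x ∉ G)
    (h : Disjoint V G) :
    Disjoint (completeEdges (insert x V) ∪ completeEdges (insert x G)) (bip V G) := by
  refine disjoint_union_left.2 ⟨?_, disjoint_completeEdges_bip (by simp [hV, h.symm])⟩
  rw [bip_comm]
  exact disjoint_completeEdges_bip (by simp [hG, h])

theorem cone_union (x : ℕ) (V G : Finset ℕ) : cone x (V ∪ G) = cone x V ∪ cone x G :=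
  image_union ..

theorem BipDec.symm {A B : Finset ℕ} (h : BipDec A B) : BipDec B A := by
  rwa [BipDec, bip_comm]

theorem BipSplit.symm {A B : Finset ℕ} (h : BipSplit A B) : BipSplit B A := by
  rwa [BipSplit, bip_comm]

theorem BipDec.union {A A' B : Finset ℕ} (h : Disjoint A A') (h₁ : Disjoint A B)
    (hA : BipDec A B) (hA' : BipDec A' B) : BipDec (A ∪ A') B := by
  obtain ⟨L, I, hM⟩ := hA
  obtain ⟨L', I', hM'⟩ := hA'
  rw [BipDec, bip_union_left]
  exact ⟨_, _, hM.union hM' (disjoint_bip h h₁)⟩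

theorem BipSplit.union {A A' B : Finset ℕ} (h : Disjoint A A') (h₁ : Disjoint A B)
    (hA : BipSplit A B) (hA' : BipSplit A' B) : BipSplit (A ∪ A') B := by
  obtain ⟨L, I, hM, hP⟩ := hA
  obtain ⟨L', I', hM', hP'⟩ := hA'
  rw [BipSplit, bip_union_left]
  have hd := disjoint_bip h h₁
  exact ⟨_, _, hM.union hM' hd, hP.union hP' (hd.mono hM.subset hM'.subset)⟩

theorem bipDec_of_card_eq {r n b k : ℕ} (hr : ∀ {A B : Finset ℕ}, Disjoint A B → A.card = r →
      B.card = b → BipDec A B) (hn : ∀ {A B : Finset ℕ}, Disjoint A B → A.card = n →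
      B.card = b → BipDec A B) {A B : Finset ℕ} (h : Disjoint A B) (hA : A.card = r + n * k)
    (hB : B.card = b) : BipDec A B := by
  refine card_induction (Q := fun A => Disjoint A B → BipDec A B) r n (fun A hA h => hr h hA hB)
    (fun k A A' hAA _ hA' ih hd => ?_) k A hA h
  rw [disjoint_union_left] at hd
  exact (ih hd.1).union hAA hd.1 (hn hd.2 hA' hB)

theorem bipSplit_of_card_eq {r n b k : ℕ} (hr : ∀ {A B : Finset ℕ}, Disjoint A B → A.card = r →
      B.card = b → BipSplit A B) (hn : ∀ {A B : Finset ℕ}, Disjoint A B → A.card = n →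
      B.card = b → BipSplit A B) {A B : Finset ℕ} (h : Disjoint A B) (hA : A.card = r + n * k)
    (hB : B.card = b) : BipSplit A B := by
  refine card_induction (Q := fun A => Disjoint A B → BipSplit A B) r n (fun A hA h => hr h hA hB)
    (fun k A A' hAA _ hA' ih hd => ?_) k A hA h
  rw [disjoint_union_left] at hd
  exact (ih hd.1).union hAA hd.1 (hn hd.2 hA' hB)

/-- `K_{m,8}` decomposes into paths with five vertices if `m ≥ 2`. -/
theorem bipDec_eight {A B : Finset ℕ} (h : Disjoint A B) (hA : 2 ≤ A.card) (hB : B.card = 8) :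
    BipDec A B := by
  -- Any size at least 2 is a sum of twos and at most one three, so K_{2,4} and K_{3,4} suffice; two
  -- copies of the result then give 8.
  have h4 {A B : Finset ℕ} (h : Disjoint A B) (hA : 2 ≤ A.card) (hB : B.card = 4) :
      BipDec A B := by
    rcases Nat.even_or_odd' A.card with ⟨k, hk | hk⟩
    · exact bipDec_of_card_eq (k := k - 1) bipDec_two_four bipDec_two_four h (by omega) hB
    · exact bipDec_of_card_eq (k := k - 1) bipDec_three_four bipDec_two_four h (by omega) hB
  obtain ⟨B', hB', hc⟩ := exists_subset_card_eq (s := B) (n := 4) (by omega)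
  rw [← sdiff_union_of_subset hB'] at h ⊢
  rw [disjoint_union_right] at h
  have hc' : (B \ B').card = 4 := by rw [card_sdiff_of_subset hB']; omega
  exact ((h4 h.1 hA hc').symm.union sdiff_disjoint h.1.symm (h4 h.2 hA hc).symm).symm

/-- Since 24 = 4 · 6 = 3 · 8, copies of K_{4,6} and K_{3,8} give K_{4,24} and K_{3,24}; `A` is cut
into fours and at most one three. -/
theorem bipSplit_twentyFour {A B : Finset ℕ} (h : Disjoint A B) (hA : A.card % 4 = 0 ∨
    A.card % 4 = 3) (hB : B.card = 24) : BipSplit A B := by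
  have h4 {A B : Finset ℕ} (h : Disjoint A B) (hA : A.card = 4) (hB : B.card = 24) :
      BipSplit A B :=
    (bipSplit_of_card_eq (k := 3) (fun h hA hB => (bipSplit_four_six h.symm hB hA).symm)
      (fun h hA hB => (bipSplit_four_six h.symm hB hA).symm) h.symm (by omega) hA).symm
  have h3 {A B : Finset ℕ} (h : Disjoint A B) (hA : A.card = 3) (hB : B.card = 24) :
      BipSplit A B :=
    (bipSplit_of_card_eq (k := 2) (fun h hA hB => (bipSplit_three_eight h.symm hB hA).symm)
      (fun h hA hB => (bipSplit_three_eight h.symm hB hA).symm) h.symm (by omega) hA).symm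
  have h0 {A B : Finset ℕ} (_ : Disjoint A B) (hA : A.card = 0) (_ : B.card = 24) :
      BipSplit A B := by
    rw [card_eq_zero] at hA
    subst hA
    exact ⟨∅, ∅, by simpa [bip] using Marked.empty, .empty⟩
  rcases hA with hA | hA
  · exact bipSplit_of_card_eq (k := A.card / 4) h0 h4 h (by omega) hB
  · exact bipSplit_of_card_eq (k := A.card / 4) h3 h4 h (by omega) hB

/-- The bipartite part has no edge at `x`, so its marked edges may be arbitrary. -/
theorem Rooted.union {x : ℕ} {V G : Finset ℕ} (hV : x ∉ V) (hG : x ∉ G) (h : Disjoint V G)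
    (h₁ : Rooted x V) (h₂ : Rooted x G) (h₃ : BipDec V G) : Rooted x (V ∪ G) := by
  obtain ⟨L₁, I₁, hM₁, hL₁⟩ := h₁
  obtain ⟨L₂, I₂, hM₂, hL₂⟩ := h₂
  obtain ⟨L₃, I₃, hM₃⟩ := h₃
  rw [Rooted, completeEdges_glue hV h, cone_union]
  exact ⟨_, _, (hM₁.union hM₂ (disjoint_completeEdges_insert h)).union hM₃
    (disjoint_glue_bip hV hG h), (union_subset_union hL₁ hL₂).trans subset_union_left⟩

/-- The stars at `x` combine, and the other marked edges lie in edge-disjoint pieces, so their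
P_4-decompositions combine too. -/
theorem RootedSplit.union {x : ℕ} {V G : Finset ℕ} (hV : x ∉ V) (hG : x ∉ G) (h : Disjoint V G)
    (h₁ : RootedSplit x V) (h₂ : RootedSplit x G) (h₃ : BipSplit V G) :
    RootedSplit x (V ∪ G) := by
  obtain ⟨L₁, I₁, hM₁, hL₁, hP₁⟩ := h₁
  obtain ⟨L₂, I₂, hM₂, hL₂, hP₂⟩ := h₂
  obtain ⟨L₃, I₃, hM₃, hP₃⟩ := h₃
  have hd : Disjoint L₁ L₂ := (disjoint_completeEdges (by
    rw [disjoint_iff_inter_eq_empty.1 h]; simp)).mono hL₁ hL₂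
  have hd' : Disjoint (L₁ ∪ L₂) L₃ := (disjoint_glue_bip hV hG h).mono
    (union_subset_union (hL₁.trans (completeEdges_mono (subset_insert _ _)))
      (hL₂.trans (completeEdges_mono (subset_insert _ _)))) hM₃.subset
  refine ⟨L₁ ∪ L₂ ∪ L₃, I₁ ∪ I₂ ∪ I₃, ?_, ?_, (hP₁.union hP₂ hd).union hP₃ hd'⟩
  · rw [completeEdges_glue hV h, cone_union]
    convert (hM₁.union hM₂ (disjoint_completeEdges_insert h)).union hM₃
      (disjoint_glue_bip hV hG h) using 1
    ext
    simp only [mem_union]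
    tauto
  · rw [completeEdges_union_disjoint h]
    exact union_subset_union (union_subset_union hL₁ hL₂) hM₃.subset

theorem CompleteSplit.union {V G : Finset ℕ} (h : Disjoint V G) (h₁ : CompleteSplit V)
    (h₂ : CompleteSplit G) (h₃ : BipSplit V G) : CompleteSplit (V ∪ G) := by
  obtain ⟨L₁, I₁, hM₁, hP₁⟩ := h₁
  obtain ⟨L₂, I₂, hM₂, hP₂⟩ := h₂
  obtain ⟨L₃, I₃, hM₃, hP₃⟩ := h₃
  have hd : Disjoint (completeEdges V) (completeEdges G) := disjoint_completeEdges (by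
    rw [disjoint_iff_inter_eq_empty.1 h]; simp)
  have hd' : Disjoint (completeEdges V ∪ completeEdges G) (bip V G) := by
    refine disjoint_union_left.2 ⟨?_, disjoint_completeEdges_bip h.symm⟩
    rw [bip_comm]
    exact disjoint_completeEdges_bip h
  rw [CompleteSplit, completeEdges_union_disjoint h]
  exact ⟨_, _, (hM₁.union hM₂ hd).union hM₃ hd', (hP₁.union hP₂ (hd.mono hM₁.subset hM₂.subset)).union
    hP₃ (hd'.mono (union_subset_union hM₁.subset hM₂.subset) hM₃.subset)⟩

theorem CompleteSplit.glue {x : ℕ} {V G : Finset ℕ} (hV : x ∉ V) (hG : x ∉ G) (h : Disjoint V G)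
    (h₁ : CompleteSplit (insert x V)) (h₂ : CompleteSplit (insert x G)) (h₃ : BipSplit V G) :
    CompleteSplit (insert x (V ∪ G)) := by
  obtain ⟨L₁, I₁, hM₁, hP₁⟩ := h₁
  obtain ⟨L₂, I₂, hM₂, hP₂⟩ := h₂
  obtain ⟨L₃, I₃, hM₃, hP₃⟩ := h₃
  have hd := disjoint_completeEdges_insert (x := x) h
  have hd' := disjoint_glue_bip hV hG h
  rw [CompleteSplit, completeEdges_glue hV h]
  exact ⟨_, _, (hM₁.union hM₂ hd).union hM₃ hd', (hP₁.union hP₂ (hd.mono hM₁.subset hM₂.subset)).union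
    hP₃ (hd'.mono (union_subset_union hM₁.subset hM₂.subset) hM₃.subset)⟩

/-- The two complete pieces already make every vertex interior, so the bipartite paths are
unconstrained. -/
theorem AllInterior.glue {x : ℕ} {V G : Finset ℕ} (hV : x ∉ V) (hG : x ∉ G) (h : Disjoint V G)
    (h₁ : AllInterior (insert x V)) (h₂ : AllInterior (insert x G)) (h₃ : BipDec V G) :
    AllInterior (insert x (V ∪ G)) := by
  obtain ⟨L₁, I₁, hM₁, hI₁⟩ := h₁
  obtain ⟨L₂, I₂, hM₂, hI₂⟩ := h₂
  obtain ⟨L₃, I₃, hM₃⟩ := h₃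
  rw [AllInterior, completeEdges_glue hV h]
  refine ⟨_, _, (hM₁.union hM₂ (disjoint_completeEdges_insert h)).union hM₃
    (disjoint_glue_bip hV hG h), Subset.trans ?_ subset_union_left⟩
  rw [insert_union_distrib]
  exact union_subset_union hI₁ hI₂

theorem rooted_of_card {x : ℕ} {V : Finset ℕ} (hx : x ∉ V) (h₀ : 7 ≤ V.card)
    (h : V.card % 8 = 0 ∨ V.card % 8 = 7) : Rooted x V := by
  have step (r : ℕ) (hr : 7 ≤ r) (base : ∀ V, V.card = r → x ∉ V → Rooted x V) (k : ℕ)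
      (V : Finset ℕ) (hV : V.card = r + 8 * k) : x ∉ V → Rooted x V := by
    refine card_induction r 8 base (fun k A B hd hA hB ih hx => ?_) k V hV
    rw [mem_union, not_or] at hx
    exact (ih hx.1).union hx.1 hx.2 hd (rooted_eight hx.2 hB) (bipDec_eight hd (by omega) hB)
  rcases h with h | h
  · exact step 8 (by omega) (fun V hV hx => rooted_eight hx hV) (V.card / 8 - 1) V (by omega) hx
  · exact step 7 (by omega) (fun V hV hx => rooted_seven hx hV) (V.card / 8) V (by omega) hx

theorem allInterior_of_card {V : Finset ℕ} (h₀ : 8 ≤ V.card)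
    (h : V.card % 8 = 0 ∨ V.card % 8 = 1) : AllInterior V := by
  obtain ⟨x, hxV⟩ := card_pos.1 (by omega : 0 < V.card)
  obtain ⟨V, hx, rfl⟩ : ∃ W, x ∉ W ∧ V = insert x W := ⟨V.erase x, by simp, (insert_erase hxV).symm⟩
  rw [card_insert_of_notMem hx] at h h₀
  have step (r : ℕ) (hr : 7 ≤ r) (base : ∀ V, V.card = r → x ∉ V → AllInterior (insert x V))
      (k : ℕ) (V : Finset ℕ) (hV : V.card = r + 8 * k) : x ∉ V → AllInterior (insert x V) := by
    refine card_induction r 8 base (fun k A B hd hA hB ih hx => ?_) k V hV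
    rw [mem_union, not_or] at hx
    exact (ih hx.1).glue hx.1 hx.2 hd
      (allInterior_nine (by rw [card_insert_of_notMem hx.2, hB])) (bipDec_eight hd (by omega) hB)
  rcases h with h | h
  · exact step 7 (by omega) (fun V hV hx => allInterior_eight
      (by rw [card_insert_of_notMem hx, hV])) (V.card / 8) V (by omega) hx
  · exact step 8 (by omega) (fun V hV hx => allInterior_nine
      (by rw [card_insert_of_notMem hx, hV])) (V.card / 8 - 1) V (by omega) hx

/-- The residues are those of v - 1 when v ≡ 0, 1 (mod 8) and v - 1 ≡ 0, 1 (mod 3). -/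
theorem rootedSplit_of_card {x : ℕ} {V : Finset ℕ} (hx : x ∉ V)
    (h : V.card % 24 = 0 ∨ V.card % 24 = 7 ∨ V.card % 24 = 15 ∨ V.card % 24 = 16) :
    RootedSplit x V := by
  have step (r : ℕ) (hr : r % 4 = 0 ∨ r % 4 = 3)
      (base : ∀ V, V.card = r → x ∉ V → RootedSplit x V) (k : ℕ)
      (V : Finset ℕ) (hV : V.card = r + 24 * k) : x ∉ V → RootedSplit x V := by
    refine card_induction r 24 base (fun k A B hd hA hB ih hx => ?_) k V hV
    rw [mem_union, not_or] at hx
    exact (ih hx.1).union hx.1 hx.2 hd (rootedSplit_twentyFour hx.2 hB)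
      (bipSplit_twentyFour hd (by omega) hB)
  rcases h with h | h | h | h
  -- K_1 has no edges, so this residue class can start from the empty set.
  · refine step 0 (by omega) (fun V hV hx => ?_) (V.card / 24) V (by omega) hx
    rw [card_eq_zero] at hV
    subst hV
    have : completeEdges {x} = ∅ := by
      ext e
      induction e with | _ x y
      simp only [mk_mem_completeEdges]
      grind
    exact ⟨∅, ∅, by simpa [this, cone] using Marked.empty, by simp, .empty⟩
  · exact step 7 (by omega) (fun V hV hx => rootedSplit_seven hx hV) (V.card / 24) V (by omega) hx
  · exact step 15 (by omega) (fun V hV hx => rootedSplit_fifteen hx hV) (V.card / 24) V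
      (by omega) hx
  · exact step 16 (by omega) (fun V hV hx => rootedSplit_sixteen hx hV) (V.card / 24) V
      (by omega) hx

/-- The residues are the v with v ≡ 0, 1 both mod 8 and mod 3. Even orders grow by a disjoint K_24,
odd orders by a K_25 sharing a vertex, so that the part facing the 24 new vertices always has size
divisible by 4. -/
theorem completeSplit_of_card {V : Finset ℕ} (h₀ : 2 ≤ V.card)
    (h : V.card % 24 = 0 ∨ V.card % 24 = 1 ∨ V.card % 24 = 9 ∨ V.card % 24 = 16) :
    CompleteSplit V := by
  have even (r : ℕ) (hr : r % 4 = 0) (base : ∀ V, V.card = r → CompleteSplit V) (k : ℕ)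
      (V : Finset ℕ) (hV : V.card = r + 24 * k) : CompleteSplit V :=
    card_induction r 24 base (fun k A B hd hA hB ih => ih.union hd (completeSplit_twentyFour hB)
      (bipSplit_twentyFour hd (by omega) hB)) k V hV
  have odd (r : ℕ) (hr : r % 4 = 1) (base : ∀ V, V.card = r → CompleteSplit V) (k : ℕ)
      (V : Finset ℕ) (hV : V.card = r + 24 * k) : CompleteSplit V := by
    obtain ⟨x, hx⟩ := card_pos.1 (by omega : 0 < V.card)
    rw [← insert_erase hx]
    -- The induction runs over the set without the shared vertex, whence `r - 1`.
    refine card_induction (Q := fun V => x ∉ V → CompleteSplit (insert x V)) (r - 1) 24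
      (fun V hV hx => base _ (by rw [card_insert_of_notMem hx]; omega))
      (fun k A B hd hA hB ih hx => ?_) k (V.erase x) (by rw [card_erase_of_mem hx]; omega)
      (notMem_erase x V)
    rw [mem_union, not_or] at hx
    exact (ih hx.1).glue hx.1 hx.2 hd
      (completeSplit_twentyFive (by rw [card_insert_of_notMem hx.2, hB]))
      (bipSplit_twentyFour hd (by omega) hB)
  rcases h with h | h | h | h
  · exact even 24 (by omega) (fun V hV => completeSplit_twentyFour hV) (V.card / 24 - 1) V
      (by omega)
  · exact odd 25 (by omega) (fun V hV => completeSplit_twentyFive hV) (V.card / 24 - 1) V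
      (by omega)
  · exact odd 9 (by omega) (fun V hV => completeSplit_nine hV) (V.card / 24) V (by omega)
  · exact even 16 (by omega) (fun V hV => completeSplit_sixteen hV) (V.card / 24) V (by omega)

/-! ### Decomposing a graph with two adjacent hubs -/

/-- The edges of the graph obtained from the empty graph on `V` by adding two adjacent vertices
`p` and `q`, both joined to all of `V`. -/
def hubs (p q : ℕ) (V : Finset ℕ) : Finset (Sym2 ℕ) := insert s(p, q) (cone p V ∪ cone q V)

theorem mk_mem_hubs {V : Finset ℕ} {p q x y : ℕ} :
    s(x, y) ∈ hubs p q V ↔ (x = p ∧ y = q ∨ x = q ∧ y = p) ∨ (x = p ∧ y ∈ V ∨ y = p ∧ x ∈ V) ∨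
      (x = q ∧ y ∈ V ∨ y = q ∧ x ∈ V) := by
  simp only [hubs, mem_insert, mem_union, mk_mem_cone, Sym2.eq_iff]

/-- States the set identities pointwise on pairs of vertices, so that each reduction below becomes a
finite case check. -/
theorem P4Dec.of_paths {ls : List (List ℕ)} {F F' : Finset (Sym2 ℕ)}
    (h : ∀ l ∈ ls, l.length = 4 ∧ l.Nodup) (hd : (ls.flatMap trail).Nodup) (hF' : P4Dec F')
    (hdis : ∀ x y, s(x, y) ∈ ls.flatMap trail → s(x, y) ∉ F')
    (hF : ∀ x y, s(x, y) ∈ F ↔ s(x, y) ∈ ls.flatMap trail ∨ s(x, y) ∈ F') : P4Dec F := by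
  have : F = (ls.flatMap trail).toFinset ∪ F' := by
    ext e
    induction e with | _ x y
    rw [hF, mem_union, List.mem_toFinset]
  rw [this]
  refine (P4Dec.of_list ls h hd).union hF' (Finset.disjoint_left.2 fun e => ?_)
  induction e with | _ x y
  rw [List.mem_toFinset]
  exact hdis x y

section Reductions

variable {p q : ℕ} {V : Finset ℕ} {L : Finset (Sym2 ℕ)}

theorem p4Dec_hubs_of_path (hp : p ∉ V) (hq : q ∉ V) (hL : L ⊆ completeEdges V) {a b c d : ℕ}
    (hn : [a, b, c, d].Nodup) (hab : s(a, b) ∈ L) (hbc : s(b, c) ∈ L) (hcd : s(c, d) ∈ L)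
    (h : P4Dec (L \ (trail [a, b, c, d]).toFinset ∪ hubs p q V)) : P4Dec (L ∪ hubs p q V) := by
  have hs : (trail [a, b, c, d]).toFinset ⊆ L := by
    intro e he
    simp only [trail, List.mem_toFinset, List.mem_cons, List.not_mem_nil, or_false] at he
    rcases he with rfl | rfl | rfl <;> assumption
  have hdis : Disjoint L (hubs p q V) := by
    refine Finset.disjoint_left.2 fun e he => ?_
    have := hL he
    induction e with | _ x y
    rw [mk_mem_completeEdges] at this
    rw [mk_mem_hubs]
    grind
  rw [← union_sdiff_of_subset hs, union_assoc]
  exact .add a b c d _ hn (disjoint_union_right.2 ⟨disjoint_sdiff, hdis.mono_left hs⟩) h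

/-- The paths a-b-p-d and c-d-q-b use up all edges at the leaves `b` and `d`, which can then be
removed. The case `a = c` is allowed. -/
theorem p4Dec_hubs_of_leaves (hpq : p ≠ q) (hp : p ∉ V) (hq : q ∉ V) (hL : L ⊆ completeEdges V)
    {a b c d : ℕ} (hbd : b ≠ d) (had : a ≠ d) (hab : s(a, b) ∈ L) (hcd : s(c, d) ∈ L)
    (hb : ∀ y, s(b, y) ∈ L → y = a) (hd : ∀ y, s(d, y) ∈ L → y = c)
    (h : P4Dec (L \ {s(a, b), s(c, d)} ∪ hubs p q (V \ {b, d}))) : P4Dec (L ∪ hubs p q V) := by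
  have hV : ∀ x y, s(x, y) ∈ L → x ∈ V ∧ y ∈ V ∧ x ≠ y := fun x y hxy =>
    mk_mem_completeEdges.1 (hL hxy)
  have hb' : ∀ y, s(y, b) ∈ L → y = a := fun y hy => hb y (Sym2.eq_swap ▸ hy)
  have hd' : ∀ y, s(y, d) ∈ L → y = c := fun y hy => hd y (Sym2.eq_swap ▸ hy)
  have hba : s(b, a) ∈ L := Sym2.eq_swap ▸ hab
  have hdc : s(d, c) ∈ L := Sym2.eq_swap ▸ hcd
  obtain ⟨haV, hbV, hab'⟩ := hV _ _ hab
  obtain ⟨hcV, hdV, hcd'⟩ := hV _ _ hcd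
  have hcb : c ≠ b := fun e => had (hb d (e ▸ hcd)).symm
  have := ne_of_mem_of_not_mem haV hp
  have := ne_of_mem_of_not_mem haV hq
  have := ne_of_mem_of_not_mem hbV hp
  have := ne_of_mem_of_not_mem hbV hq
  have := ne_of_mem_of_not_mem hcV hp
  have := ne_of_mem_of_not_mem hcV hq
  have := ne_of_mem_of_not_mem hdV hp
  have := ne_of_mem_of_not_mem hdV hq
  refine .of_paths (ls := [[a, b, p, d], [c, d, q, b]]) ?_ ?_ h ?_ ?_
  · simp only [List.mem_cons, List.not_mem_nil, or_false, forall_eq_or_imp, forall_eq,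
      List.nodup_cons]
    grind
  · simp only [trail, List.flatMap_cons, List.flatMap_nil, List.cons_append, List.nil_append,
      List.append_nil, List.nodup_cons, List.mem_cons, Sym2.eq_iff]
    grind
  · intro x y
    simp only [trail, List.flatMap_cons, List.flatMap_nil, List.cons_append, List.nil_append,
      List.append_nil, List.mem_cons, List.not_mem_nil, or_false, Sym2.eq_iff, mem_union,
      mem_sdiff, mem_insert, mem_singleton, mk_mem_hubs]
    rintro (h | h | h | h | h | h) <;> obtain ⟨rfl, rfl⟩ | ⟨rfl, rfl⟩ := h <;> grind
  · intro x y
    simp only [trail, List.flatMap_cons, List.flatMap_nil, List.cons_append, List.nil_append,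
      List.append_nil, List.mem_cons, List.not_mem_nil, or_false, Sym2.eq_iff, mem_union,
      mem_sdiff, mem_insert, mem_singleton, mk_mem_hubs]
    constructor
    · grind
    · rintro ((h | h | h | h | h | h) | h)
      · obtain ⟨rfl, rfl⟩ | ⟨rfl, rfl⟩ := h <;> grind
      · obtain ⟨rfl, rfl⟩ | ⟨rfl, rfl⟩ := h <;> grind
      · obtain ⟨rfl, rfl⟩ | ⟨rfl, rfl⟩ := h <;> grind
      · obtain ⟨rfl, rfl⟩ | ⟨rfl, rfl⟩ := h <;> grind
      · obtain ⟨rfl, rfl⟩ | ⟨rfl, rfl⟩ := h <;> grind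
      · obtain ⟨rfl, rfl⟩ | ⟨rfl, rfl⟩ := h <;> grind
      · grind

/-- The three paths from `p` to `q` through one side of the triangle each use exactly its sides and
its edges to the hubs. -/
theorem p4Dec_hubs_of_triangle (hpq : p ≠ q) (hp : p ∉ V) (hq : q ∉ V)
    (hL : L ⊆ completeEdges V) {a b c : ℕ} (hab : s(a, b) ∈ L) (hbc : s(b, c) ∈ L)
    (hca : s(c, a) ∈ L) (ha : ∀ y, s(a, y) ∈ L → y = b ∨ y = c)
    (hb : ∀ y, s(b, y) ∈ L → y = a ∨ y = c) (hc : ∀ y, s(c, y) ∈ L → y = a ∨ y = b)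
    (h : P4Dec (L \ {s(a, b), s(b, c), s(c, a)} ∪ hubs p q (V \ {a, b, c}))) :
    P4Dec (L ∪ hubs p q V) := by
  have hV : ∀ x y, s(x, y) ∈ L → x ∈ V ∧ y ∈ V ∧ x ≠ y := fun x y hxy =>
    mk_mem_completeEdges.1 (hL hxy)
  have hba : s(b, a) ∈ L := Sym2.eq_swap ▸ hab
  have hcb : s(c, b) ∈ L := Sym2.eq_swap ▸ hbc
  have hac : s(a, c) ∈ L := Sym2.eq_swap ▸ hca
  obtain ⟨haV, hbV, hab'⟩ := hV _ _ hab
  obtain ⟨-, hcV, hbc'⟩ := hV _ _ hbc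
  have hac' := (hV _ _ hac).2.2
  have := ne_of_mem_of_not_mem haV hp
  have := ne_of_mem_of_not_mem haV hq
  have := ne_of_mem_of_not_mem hbV hp
  have := ne_of_mem_of_not_mem hbV hq
  have := ne_of_mem_of_not_mem hcV hp
  have := ne_of_mem_of_not_mem hcV hq
  refine .of_paths (ls := [[p, a, b, q], [p, b, c, q], [p, c, a, q]]) ?_ ?_ h ?_ ?_
  · simp only [List.mem_cons, List.not_mem_nil, or_false, forall_eq_or_imp, forall_eq,
      List.nodup_cons]
    grind
  · simp only [trail, List.flatMap_cons, List.flatMap_nil, List.cons_append, List.nil_append,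
      List.append_nil, List.nodup_cons, List.mem_cons, Sym2.eq_iff]
    grind
  · intro x y
    simp only [trail, List.flatMap_cons, List.flatMap_nil, List.cons_append, List.nil_append,
      List.append_nil, List.mem_cons, List.not_mem_nil, or_false, Sym2.eq_iff, mem_union,
      mem_sdiff, mem_insert, mem_singleton, mk_mem_hubs]
    rintro (h | h | h | h | h | h | h | h | h) <;> obtain ⟨rfl, rfl⟩ | ⟨rfl, rfl⟩ := h <;> grind
  · intro x y
    simp only [trail, List.flatMap_cons, List.flatMap_nil, List.cons_append, List.nil_append,
      List.append_nil, List.mem_cons, List.not_mem_nil, or_false, Sym2.eq_iff, mem_union,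
      mem_sdiff, mem_insert, mem_singleton, mk_mem_hubs]
    constructor
    · grind
    · rintro ((h | h | h | h | h | h | h | h | h) | h)
      all_goals first
        | (obtain ⟨rfl, rfl⟩ | ⟨rfl, rfl⟩ := h <;> grind)
        | grind

/-- The six edges from three vertices to the hubs form two paths. Isolation matters only to the
caller, which needs `L` to live on the smaller vertex set. -/
theorem p4Dec_hubs_of_isolated (hpq : p ≠ q) (hp : p ∉ V) (hq : q ∉ V)
    (hL : L ⊆ completeEdges V) {a b c : ℕ} (hab : a ≠ b) (hac : a ≠ c) (hbc : b ≠ c)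
    (haV : a ∈ V) (hbV : b ∈ V) (hcV : c ∈ V) (h : P4Dec (L ∪ hubs p q (V \ {a, b, c}))) :
    P4Dec (L ∪ hubs p q V) := by
  have hV : ∀ x y, s(x, y) ∈ L → x ∈ V ∧ y ∈ V ∧ x ≠ y := fun x y hxy =>
    mk_mem_completeEdges.1 (hL hxy)
  have := ne_of_mem_of_not_mem haV hp
  have := ne_of_mem_of_not_mem haV hq
  have := ne_of_mem_of_not_mem hbV hp
  have := ne_of_mem_of_not_mem hbV hq
  have := ne_of_mem_of_not_mem hcV hp
  have := ne_of_mem_of_not_mem hcV hq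
  refine .of_paths (ls := [[a, p, b, q], [p, c, q, a]]) ?_ ?_ h ?_ ?_
  · simp only [List.mem_cons, List.not_mem_nil, or_false, forall_eq_or_imp, forall_eq,
      List.nodup_cons]
    grind
  · simp only [trail, List.flatMap_cons, List.flatMap_nil, List.cons_append, List.nil_append,
      List.append_nil, List.nodup_cons, List.mem_cons, Sym2.eq_iff]
    grind
  · intro x y
    simp only [trail, List.flatMap_cons, List.flatMap_nil, List.cons_append, List.nil_append,
      List.append_nil, List.mem_cons, List.not_mem_nil, or_false, Sym2.eq_iff, mem_union,
      mem_sdiff, mem_insert, mem_singleton, mk_mem_hubs]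
    rintro (h | h | h | h | h | h) <;> obtain ⟨rfl, rfl⟩ | ⟨rfl, rfl⟩ := h <;> grind
  · intro x y
    simp only [trail, List.flatMap_cons, List.flatMap_nil, List.cons_append, List.nil_append,
      List.append_nil, List.mem_cons, List.not_mem_nil, or_false, Sym2.eq_iff, mem_union,
      mem_sdiff, mem_insert, mem_singleton, mk_mem_hubs]
    constructor
    · grind
    · rintro ((h | h | h | h | h | h) | h)
      all_goals first
        | (obtain ⟨rfl, rfl⟩ | ⟨rfl, rfl⟩ := h <;> grind)
        | grind

end Reductions

/-- This and the next three lemmas are the terminal cases, where a reduction would leave fewer than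
two vertices or none applies. -/
theorem p4Dec_hubs_four {p q a b c d : ℕ} (h : [a, b, c, d, p, q].Nodup) :
    P4Dec (∅ ∪ hubs p q {a, b, c, d}) := by
  simp only [List.nodup_cons, List.mem_cons, List.not_mem_nil, or_false, not_or] at h
  refine .of_paths (ls := [[a, p, q, b], [b, p, c, q], [a, q, d, p]]) ?_ ?_ .empty
    (fun _ _ _ => notMem_empty _) ?_
  · simp only [List.mem_cons, List.not_mem_nil, or_false, forall_eq_or_imp, forall_eq,
      List.nodup_cons]
    grind
  · simp only [trail, List.flatMap_cons, List.flatMap_nil, List.cons_append, List.nil_append,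
      List.append_nil, List.nodup_cons, List.mem_cons, Sym2.eq_iff]
    grind
  · intro x y
    simp only [trail, List.flatMap_cons, List.flatMap_nil, List.cons_append, List.nil_append,
      List.append_nil, List.mem_cons, List.not_mem_nil, or_false, Sym2.eq_iff, mem_union,
      mem_insert, mem_singleton, mk_mem_hubs, notMem_empty]
    constructor
    · grind
    · rintro (h | h | h | h | h | h | h | h | h) <;> obtain ⟨rfl, rfl⟩ | ⟨rfl, rfl⟩ := h <;> simp

theorem p4Dec_hubs_path {p q a m b : ℕ} (h : [a, m, b, p, q].Nodup) :
    P4Dec ({s(a, m), s(m, b)} ∪ hubs p q {a, m, b}) := by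
  simp only [List.nodup_cons, List.mem_cons, List.not_mem_nil, or_false, not_or] at h
  refine .of_paths (ls := [[a, m, b, p], [a, p, q, b], [a, q, m, p]]) ?_ ?_ .empty
    (fun _ _ _ => notMem_empty _) ?_
  · simp only [List.mem_cons, List.not_mem_nil, or_false, forall_eq_or_imp, forall_eq,
      List.nodup_cons]
    grind
  · simp only [trail, List.flatMap_cons, List.flatMap_nil, List.cons_append, List.nil_append,
      List.append_nil, List.nodup_cons, List.mem_cons, Sym2.eq_iff]
    grind
  · intro x y
    simp only [trail, List.flatMap_cons, List.flatMap_nil, List.cons_append, List.nil_append,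
      List.append_nil, List.mem_cons, List.not_mem_nil, or_false, Sym2.eq_iff, mem_union,
      mem_insert, mem_singleton, mk_mem_hubs, notMem_empty]
    constructor
    · grind
    · rintro (h | h | h | h | h | h | h | h | h) <;> obtain ⟨rfl, rfl⟩ | ⟨rfl, rfl⟩ := h <;> simp

theorem p4Dec_hubs_triangle_point {p q a b c d : ℕ} (h : [a, b, c, d, p, q].Nodup) :
    P4Dec ({s(a, b), s(b, c), s(c, a)} ∪ hubs p q {a, b, c, d}) := by
  simp only [List.nodup_cons, List.mem_cons, List.not_mem_nil, or_false, not_or] at h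
  refine .of_paths (ls := [[d, p, q, a], [d, q, b, p], [q, c, a, b], [a, p, c, b]]) ?_ ?_ .empty
    (fun _ _ _ => notMem_empty _) ?_
  · simp only [List.mem_cons, List.not_mem_nil, or_false, forall_eq_or_imp, forall_eq,
      List.nodup_cons]
    grind
  · simp only [trail, List.flatMap_cons, List.flatMap_nil, List.cons_append, List.nil_append,
      List.append_nil, List.nodup_cons, List.mem_cons, Sym2.eq_iff]
    grind
  · intro x y
    simp only [trail, List.flatMap_cons, List.flatMap_nil, List.cons_append, List.nil_append,
      List.append_nil, List.mem_cons, List.not_mem_nil, or_false, Sym2.eq_iff, mem_union,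
      mem_insert, mem_singleton, mk_mem_hubs, notMem_empty]
    constructor
    · grind
    · rintro (h | h | h | h | h | h | h | h | h | h | h | h) <;> obtain ⟨rfl, rfl⟩ | ⟨rfl, rfl⟩ := h <;> simp

theorem p4Dec_hubs_edge {p q a b : ℕ} (h : [a, b, p, q].Nodup) :
    P4Dec ({s(a, b)} ∪ hubs p q {a, b}) := by
  simp only [List.nodup_cons, List.mem_cons, List.not_mem_nil, or_false, not_or] at h
  refine .of_paths (ls := [[a, b, p, q], [b, q, a, p]]) ?_ ?_ .empty
    (fun _ _ _ => notMem_empty _) ?_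
  · simp only [List.mem_cons, List.not_mem_nil, or_false, forall_eq_or_imp, forall_eq,
      List.nodup_cons]
    grind
  · simp only [trail, List.flatMap_cons, List.flatMap_nil, List.cons_append, List.nil_append,
      List.append_nil, List.nodup_cons, List.mem_cons, Sym2.eq_iff]
    grind
  · intro x y
    simp only [trail, List.flatMap_cons, List.flatMap_nil, List.cons_append, List.nil_append,
      List.append_nil, List.mem_cons, List.not_mem_nil, or_false, Sym2.eq_iff, mem_union,
      mem_insert, mem_singleton, mk_mem_hubs, notMem_empty]
    constructor
    · grind
    · rintro (h | h | h | h | h | h) <;> obtain ⟨rfl, rfl⟩ | ⟨rfl, rfl⟩ := h <;> simp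

/-- In a graph without paths on four vertices in which any two leaves are adjacent, an edge meeting
another edge lies in a triangle that is a connected component. -/
theorem triangle_of_adj {L : Finset (Sym2 ℕ)} {m a b : ℕ} (hne : ∀ x y, s(x, y) ∈ L → x ≠ y)
    (h₁ : ∀ a b c d, [a, b, c, d].Nodup → s(a, b) ∈ L → s(b, c) ∈ L → s(c, d) ∉ L)
    (h₂ : ∀ a b c d, b ≠ d → a ≠ d → s(a, b) ∈ L → s(c, d) ∈ L → (∀ y, s(b, y) ∈ L → y = a) →
      ∃ y, s(d, y) ∈ L ∧ y ≠ c) (hab : a ≠ b) (hma : s(m, a) ∈ L) (hmb : s(m, b) ∈ L) :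
    s(a, b) ∈ L ∧ (∀ y, s(m, y) ∈ L → y = a ∨ y = b) ∧ (∀ y, s(a, y) ∈ L → y = m ∨ y = b) ∧
      (∀ y, s(b, y) ∈ L → y = m ∨ y = a) := by
  have hma' := hne _ _ hma
  have hmb' := hne _ _ hmb
  have ha : ∀ y, s(a, y) ∈ L → y = m ∨ y = b := fun y hy => by
    by_contra! hc
    refine h₁ y a m b ?_ (Sym2.eq_swap ▸ hy) (Sym2.eq_swap ▸ hma) hmb
    have := hne _ _ hy
    simp only [List.nodup_cons, List.mem_cons]
    grind
  have hb : ∀ y, s(b, y) ∈ L → y = m ∨ y = a := fun y hy => by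
    by_contra! hc
    refine h₁ y b m a ?_ (Sym2.eq_swap ▸ hy) (Sym2.eq_swap ▸ hmb) hma
    have := hne _ _ hy
    simp only [List.nodup_cons, List.mem_cons]
    grind
  have habL : s(a, b) ∈ L := by
    by_contra hc
    obtain ⟨y, hy, hym⟩ := h₂ m a m b hab hmb' hma hmb fun y hy => by
      rcases ha y hy with rfl | rfl
      · rfl
      · exact absurd hy hc
    rcases hb y hy with rfl | rfl
    · exact hym rfl
    · exact hc (Sym2.eq_swap ▸ hy)
  refine ⟨habL, fun y hy => ?_, ha, hb⟩
  by_contra! hc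
  refine h₁ y m a b ?_ (Sym2.eq_swap ▸ hy) hma habL
  have := hne _ _ hy
  simp only [List.nodup_cons, List.mem_cons]
  grind

/-- Adding two adjacent vertices joined to everything makes any graph with at least two vertices
decompose into paths with four vertices, provided that the number of edges is right. -/
theorem p4Dec_hubs {p q : ℕ} (hpq : p ≠ q) {V : Finset ℕ} (hp : p ∉ V) (hq : q ∉ V)
    {L : Finset (Sym2 ℕ)} (hL : L ⊆ completeEdges V) (hV : 2 ≤ V.card)
    (h3 : 3 ∣ L.card + 2 * V.card + 1) : P4Dec (L ∪ hubs p q V) := by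
  -- Each reduction preserves `L.card + 2 * V.card + 1` mod 3: it removes 3 edges in all for a path,
  -- 6 for two leaves or three isolated vertices, and 9 for a triangle.
  induction hN : V.card + L.card using Nat.strong_induction_on generalizing V L with
  | _ N ih
  subst hN
  have hmem : ∀ x y, s(x, y) ∈ L → x ∈ V ∧ y ∈ V ∧ x ≠ y := fun x y hxy =>
    mk_mem_completeEdges.1 (hL hxy)
  have hne : ∀ x y, s(x, y) ∈ L → x ≠ y := fun x y hxy => (hmem x y hxy).2.2
  have hsymm : ∀ x y, s(x, y) ∈ L → s(y, x) ∈ L := fun x y hxy => Sym2.eq_swap ▸ hxy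
  by_cases h₁ : ∀ a b c d, [a, b, c, d].Nodup → s(a, b) ∈ L → s(b, c) ∈ L → s(c, d) ∉ L
  swap
  · push Not at h₁
    obtain ⟨a, b, c, d, hn, hab, hbc, hcd⟩ := h₁
    have hs : (trail [a, b, c, d]).toFinset ⊆ L := by
      intro e he
      simp only [trail, List.mem_toFinset, List.mem_cons, List.not_mem_nil, or_false] at he
      rcases he with rfl | rfl | rfl <;> assumption
    have hc : (trail [a, b, c, d]).toFinset.card = 3 := by
      simp only [List.nodup_cons, List.mem_cons] at hn
      rw [List.toFinset_card_of_nodup]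
      · rfl
      · simp only [trail, List.nodup_cons, List.mem_cons, Sym2.eq_iff]
        grind
    have hc' := card_sdiff_of_subset hs
    have hle := card_le_card hs
    exact p4Dec_hubs_of_path hp hq hL hn hab hbc hcd
      (ih _ (by omega) hp hq (sdiff_subset.trans hL) hV (by omega) rfl)
  by_cases h₂ : ∀ a b c d, b ≠ d → a ≠ d → s(a, b) ∈ L → s(c, d) ∈ L →
      (∀ y, s(b, y) ∈ L → y = a) → ∃ y, s(d, y) ∈ L ∧ y ≠ c
  swap
  · push Not at h₂
    obtain ⟨a, b, c, d, hbd, had, hab, hcd, hb, hd⟩ := h₂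
    obtain ⟨haV, hbV, hab'⟩ := hmem _ _ hab
    obtain ⟨hcV, hdV, hcd'⟩ := hmem _ _ hcd
    have hcb : c ≠ b := fun e => had (hb d (e ▸ hcd)).symm
    have hbd2 : ({b, d} : Finset ℕ).card = 2 := card_pair hbd
    have hbdV : ({b, d} : Finset ℕ) ⊆ V := by simp [insert_subset_iff, hbV, hdV]
    have hVc := card_sdiff_of_subset hbdV
    have hs : {s(a, b), s(c, d)} ⊆ L := by simp [insert_subset_iff, hab, hcd]
    have hs2 : ({s(a, b), s(c, d)} : Finset (Sym2 ℕ)).card = 2 := by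
      refine card_pair ?_
      rw [Ne, Sym2.eq_iff]
      grind
    have hLc := card_sdiff_of_subset hs
    have hle := card_le_card hs
    -- At least two vertices must remain: over a single vertex the hubs form a triangle, which has
    -- three edges but is not a path.
    by_cases h4 : 4 ≤ V.card
    · refine p4Dec_hubs_of_leaves hpq hp hq hL hbd had hab hcd hb hd
        (ih _ (by omega) (by simp [hp]) (by simp [hq]) ?_ (by omega) (by omega) rfl)
      intro e
      induction e with | _ x y
      simp only [mem_sdiff, mem_insert, mem_singleton, mk_mem_completeEdges, Sym2.eq_iff]
      rintro ⟨hxy, hxy'⟩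
      have hyx := hsymm x y hxy
      have h₃ : x = b → y = a := fun e => hb y (e ▸ hxy)
      have h₄ : y = b → x = a := fun e => hb x (e ▸ hyx)
      have h₅ : x = d → y = c := fun e => hd y (e ▸ hxy)
      have h₆ : y = d → x = c := fun e => hd x (e ▸ hyx)
      obtain ⟨hx, hy, hxy''⟩ := hmem x y hxy
      clear h₁ ih hb hd hmem
      grind
    · have h3c : V.card = 3 := by
        have : ({a, b, d} : Finset ℕ).card = 3 := by rw [card_eq_three]; exact ⟨a, b, d, by grind⟩
        have := card_le_card (s := {a, b, d}) (t := V) (by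
          simp [insert_subset_iff, haV, hbV, hdV])
        omega
      have hVeq : V = {b, a, d} := by
        refine (eq_of_subset_of_card_le (by simp [insert_subset_iff, haV, hbV, hdV]) ?_).symm
        rw [h3c, card_eq_three.2 ⟨b, a, d, hab'.symm, hbd, had, rfl⟩]
      obtain rfl : c = a := by
        rw [hVeq] at hcV
        simp only [mem_insert, mem_singleton] at hcV
        grind
      have hLeq : L = {s(b, c), s(c, d)} := by
        ext e
        induction e with | _ x y
        simp only [mem_insert, mem_singleton, Sym2.eq_iff]
        constructor
        · intro hxy
          have hyx := hsymm x y hxy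
          have h₃ : x = b → y = c := fun e => hb y (e ▸ hxy)
          have h₄ : y = b → x = c := fun e => hb x (e ▸ hyx)
          have h₅ : x = d → y = c := fun e => hd y (e ▸ hxy)
          have h₆ : y = d → x = c := fun e => hd x (e ▸ hyx)
          obtain ⟨hx, hy, hxy''⟩ := hmem x y hxy
          rw [hVeq] at hx hy
          simp only [mem_insert, mem_singleton] at hx hy
          clear h₁ ih hb hd hmem
          grind
        · rintro ((⟨rfl, rfl⟩ | ⟨rfl, rfl⟩) | ⟨rfl, rfl⟩ | ⟨rfl, rfl⟩) <;> grind
      rw [hLeq, hVeq]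
      refine p4Dec_hubs_path ?_
      rw [hVeq] at hp hq
      simp only [mem_insert, mem_singleton, List.nodup_cons, List.mem_cons] at hp hq ⊢
      grind
  by_cases h₄ : ∃ m a b, a ≠ b ∧ s(m, a) ∈ L ∧ s(m, b) ∈ L
  · obtain ⟨a, b, c, hbc', hab, hac⟩ := h₄
    obtain ⟨hbc, ha, hb, hc⟩ := triangle_of_adj hne h₁ h₂ hbc' hab hac
    have hca := hsymm _ _ hac
    obtain ⟨haV, hbV, hab'⟩ := hmem _ _ hab
    obtain ⟨-, hcV, hac'⟩ := hmem _ _ hac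
    have hT : ({a, b, c} : Finset ℕ).card = 3 := card_eq_three.2 ⟨a, b, c, hab', hac', hbc', rfl⟩
    have hTV : ({a, b, c} : Finset ℕ) ⊆ V := by simp [insert_subset_iff, haV, hbV, hcV]
    have hVc := card_sdiff_of_subset hTV
    have hVle := card_le_card hTV
    have hs : {s(a, b), s(b, c), s(c, a)} ⊆ L := by simp [insert_subset_iff, hab, hbc, hca]
    have hs3 : ({s(a, b), s(b, c), s(c, a)} : Finset (Sym2 ℕ)).card = 3 := by
      refine card_eq_three.2 ⟨_, _, _, ?_, ?_, ?_, rfl⟩ <;> rw [Ne, Sym2.eq_iff] <;> grind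
    have hLc := card_sdiff_of_subset hs
    have hle := card_le_card hs
    have hsub : L \ {s(a, b), s(b, c), s(c, a)} ⊆ completeEdges (V \ {a, b, c}) := by
      intro e
      induction e with | _ x y
      simp only [mem_sdiff, mem_insert, mem_singleton, mk_mem_completeEdges, Sym2.eq_iff]
      rintro ⟨hxy, hxy'⟩
      have hyx := hsymm x y hxy
      have hax : x = a → y = b ∨ y = c := fun e => ha y (e ▸ hxy)
      have hay : y = a → x = b ∨ x = c := fun e => ha x (e ▸ hyx)
      have hbx : x = b → y = a ∨ y = c := fun e => hb y (e ▸ hxy)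
      have hby : y = b → x = a ∨ x = c := fun e => hb x (e ▸ hyx)
      have hcx : x = c → y = a ∨ y = b := fun e => hc y (e ▸ hxy)
      have hcy : y = c → x = a ∨ x = b := fun e => hc x (e ▸ hyx)
      obtain ⟨hx, hy, hxy''⟩ := hmem x y hxy
      clear h₁ h₂ ih ha hb hc hmem
      grind
    -- Below five vertices, divisibility rules out three, so the triangle is accompanied by one
    -- further vertex.
    by_cases h5 : 5 ≤ V.card
    · exact p4Dec_hubs_of_triangle hpq hp hq hL hab hbc hca ha hb hc
        (ih _ (by omega) (by simp [hp]) (by simp [hq]) hsub (by omega) (by omega) rfl)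
    · have hL0 : L \ {s(a, b), s(b, c), s(c, a)} = ∅ := by
        have : (completeEdges (V \ {a, b, c})).card = 0 := by
          rw [card_completeEdges, hVc, hT]
          exact Nat.choose_eq_zero_of_lt (by omega)
        rw [card_eq_zero] at this
        exact subset_empty.1 (this ▸ hsub)
      rw [hL0, card_empty] at hLc
      have hd1 : (V \ {a, b, c}).card = 1 := by omega
      obtain ⟨d, hd⟩ := card_eq_one.1 hd1
      have hVeq : V = {a, b, c, d} := by
        rw [← union_sdiff_of_subset hTV, hd]
        ext
        simp only [mem_union, mem_insert, mem_singleton]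
        tauto
      have hdm : d ∈ V \ {a, b, c} := by simp [hd]
      simp only [mem_sdiff, mem_insert, mem_singleton] at hdm
      rw [← union_sdiff_of_subset hs, hL0, union_empty, hVeq]
      refine p4Dec_hubs_triangle_point ?_
      rw [hVeq] at hp hq
      simp only [mem_insert, mem_singleton, List.nodup_cons, List.mem_cons] at hp hq ⊢
      grind
  push Not at h₄
  -- From here on no two edges of `L` meet.
  by_cases h₅ : ∃ a b c, a ≠ b ∧ a ≠ c ∧ b ≠ c ∧ a ∈ V ∧ b ∈ V ∧ c ∈ V ∧ (∀ y, s(a, y) ∉ L) ∧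
      (∀ y, s(b, y) ∉ L) ∧ ∀ y, s(c, y) ∉ L
  · obtain ⟨a, b, c, hab, hac, hbc, haV, hbV, hcV, ha, hb, hc⟩ := h₅
    have hT : ({a, b, c} : Finset ℕ).card = 3 := card_eq_three.2 ⟨a, b, c, hab, hac, hbc, rfl⟩
    have hTV : ({a, b, c} : Finset ℕ) ⊆ V := by simp [insert_subset_iff, haV, hbV, hcV]
    have hVc := card_sdiff_of_subset hTV
    have hVle := card_le_card hTV
    have hsub : L ⊆ completeEdges (V \ {a, b, c}) := by
      intro e
      induction e with | _ x y
      simp only [mem_sdiff, mem_insert, mem_singleton, mk_mem_completeEdges]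
      intro hxy
      have := hmem x y hxy
      have := hsymm x y hxy
      grind
    by_cases h5 : 5 ≤ V.card
    · exact p4Dec_hubs_of_isolated hpq hp hq hL hab hac hbc haV hbV hcV
        (ih _ (by omega) (by simp [hp]) (by simp [hq]) hsub (by omega) (by omega) rfl)
    · have hL0 : L = ∅ := by
        have : (completeEdges (V \ {a, b, c})).card = 0 := by
          rw [card_completeEdges, hVc, hT]
          exact Nat.choose_eq_zero_of_lt (by omega)
        rw [card_eq_zero] at this
        exact subset_empty.1 (this ▸ hsub)
      subst hL0
      rw [card_empty] at h3
      have hd1 : (V \ {a, b, c}).card = 1 := by omega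
      obtain ⟨d, hd⟩ := card_eq_one.1 hd1
      have hVeq : V = {a, b, c, d} := by
        rw [← union_sdiff_of_subset hTV, hd]
        ext
        simp only [mem_union, mem_insert, mem_singleton]
        tauto
      have hdm : d ∈ V \ {a, b, c} := by simp [hd]
      simp only [mem_sdiff, mem_insert, mem_singleton] at hdm
      rw [hVeq]
      refine p4Dec_hubs_four ?_
      rw [hVeq] at hp hq
      simp only [mem_insert, mem_singleton, List.nodup_cons, List.mem_cons] at hp hq ⊢
      grind
  -- At most one edge and at most two isolated vertices remain.
  have hiso (W : Finset ℕ) (hW : W ⊆ V) (hWL : ∀ x ∈ W, ∀ y, s(x, y) ∉ L) : W.card ≤ 2 := by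
    by_contra! hc
    obtain ⟨a, ha, b, hb, c, hc, hab, hac, hbc⟩ := two_lt_card.1 hc
    exact h₅ ⟨a, b, c, hab, hac, hbc, hW ha, hW hb, hW hc, hWL a ha, hWL b hb, hWL c hc⟩
  rcases L.eq_empty_or_nonempty with rfl | ⟨e, he⟩
  · have := hiso V subset_rfl (by simp)
    rw [card_empty] at h3
    omega
  induction e with | _ a b
  obtain ⟨haV, hbV, hab⟩ := hmem _ _ he
  have he' := hsymm _ _ he
  have huniq : ∀ x y, s(x, y) ∈ L → x = a ∨ x = b := by
    intro x y hxy
    -- In a matching every endpoint is a leaf, so a second edge would contradict `h₂`.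
    by_contra! hc
    obtain ⟨z, hz, hza⟩ := h₂ b a y x hc.1.symm hc.2.symm he' (hsymm _ _ hxy) fun z hz => by
      by_contra hzb
      exact h₄ a z b hzb hz he
    exact h₄ x y z hza.symm hxy hz
  have hLeq : L = {s(a, b)} := by
    ext e
    induction e with | _ x y
    simp only [mem_singleton, Sym2.eq_iff]
    constructor
    · intro hxy
      have := huniq x y hxy
      have := huniq y x (hsymm _ _ hxy)
      have := hne x y hxy
      grind
    · rintro (⟨rfl, rfl⟩ | ⟨rfl, rfl⟩) <;> assumption
  have habV : ({a, b} : Finset ℕ) ⊆ V := by simp [insert_subset_iff, haV, hbV]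
  have h2 := hiso (V \ {a, b}) sdiff_subset fun x hx y hxy => by
    simp only [mem_sdiff, mem_insert, mem_singleton] at hx
    exact hx.2 (huniq x y hxy)
  rw [card_sdiff_of_subset habV, card_pair hab] at h2
  rw [hLeq, card_singleton] at h3
  -- With one edge and between two and four vertices, divisibility leaves only two.
  have hVeq : {a, b} = V := eq_of_subset_of_card_le habV (by rw [card_pair hab]; omega)
  subst hVeq
  rw [hLeq]
  refine p4Dec_hubs_edge ?_
  simp only [mem_insert, mem_singleton, List.nodup_cons, List.mem_cons] at hp hq ⊢
  grind

/-- A variant of `p4Dec_hubs` for the complement of a graph. -/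
theorem p4Dec_completeEdges_sdiff {S : Finset ℕ} {F : Finset (Sym2 ℕ)} {p q : ℕ} (hpq : p ≠ q)
    (hp : p ∈ S) (hq : q ∈ S) (hF : F ⊆ completeEdges (S \ {p, q})) (h4 : 4 ≤ S.card)
    (hS : 3 ∣ (completeEdges S).card) (h3 : 3 ∣ F.card) : P4Dec (completeEdges S \ F) := by
  have hpS : ({p, q} : Finset ℕ) ⊆ S := by simp [insert_subset_iff, hp, hq]
  have hV := card_sdiff_of_subset hpS
  rw [card_pair hpq] at hV
  have heq : completeEdges S \ F = completeEdges (S \ {p, q}) \ F ∪ hubs p q (S \ {p, q}) := by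
    ext e
    have := @hF e
    induction e with | _ x y
    simp only [mem_sdiff, mem_union, mk_mem_completeEdges, mk_mem_hubs, mem_insert,
      mem_singleton] at this ⊢
    grind
  rw [heq]
  refine p4Dec_hubs hpq (by simp) (by simp) sdiff_subset (by omega) ?_
  have h₁ := card_sdiff_of_subset hF
  have h₂ := card_le_card hF
  rw [card_completeEdges] at hS h₁ h₂
  obtain ⟨n, hn⟩ : ∃ n, S.card = n + 2 := ⟨S.card - 2, by omega⟩
  -- The hubs account for 2n + 1 edges, so the count needed is the number of edges of the complete
  -- graph on `S` minus `F.card`.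
  have hch : (n + 2).choose 2 = n.choose 2 + (2 * n + 1) := by
    rw [Nat.choose_succ_succ' (n + 1) 1, Nat.choose_succ_succ' n 1, Nat.choose_one_right,
      Nat.choose_one_right, one_add_one_eq_two]
    omega
  rw [hn, hch] at hS
  rw [show (S \ {p, q}).card = n by omega] at h₁ h₂ ⊢
  omega

/-! ### Paths as subgraphs -/

theorem mem_trail {l : List ℕ} {e : Sym2 ℕ} :
    e ∈ trail l ↔ ∃ (i : ℕ) (h : i + 1 < l.length), e = s(l[i], l[i + 1]) := by
  induction l with
  | nil => simp [trail]
  | cons a l ih =>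
    cases l with
    | nil => simp [trail]
    | cons b l =>
      rw [trail, List.mem_cons, ih]
      constructor
      · rintro (rfl | ⟨i, h, rfl⟩)
        · exact ⟨0, by simp, rfl⟩
        · exact ⟨i + 1, by simpa using h, rfl⟩
      · rintro ⟨_ | i, h, rfl⟩
        · exact .inl rfl
        · exact .inr ⟨i, by simpa using h, rfl⟩

theorem mem_of_mem_trail {l : List ℕ} {x y : ℕ} (h : s(x, y) ∈ trail l) : x ∈ l := by
  obtain ⟨i, hi, h⟩ := mem_trail.1 h
  rcases Sym2.eq_iff.1 h with ⟨rfl, -⟩ | ⟨rfl, -⟩ <;> simp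

theorem exists_mem_trail {l : List ℕ} {x : ℕ} (hl : 2 ≤ l.length) (hx : x ∈ l) :
    ∃ y, s(x, y) ∈ trail l := by
  obtain ⟨i, hi, rfl⟩ := List.mem_iff_getElem.1 hx
  rcases i with _ | i
  · exact ⟨l[1], mem_trail.2 ⟨0, hl, rfl⟩⟩
  · exact ⟨l[i], mem_trail.2 ⟨i, hi, Sym2.eq_swap⟩⟩

theorem mk_getElem_mem_trail {l : List ℕ} (hn : l.Nodup) {i j : ℕ} (hi : i < l.length)
    (hj : j < l.length) : s(l[i], l[j]) ∈ trail l ↔ i + 1 = j ∨ j + 1 = i := by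
  rw [mem_trail]
  constructor
  · rintro ⟨k, hk, h⟩
    simp only [Sym2.eq_iff, hn.getElem_inj_iff] at h
    omega
  · rintro (rfl | rfl)
    · exact ⟨i, hj, rfl⟩
    · exact ⟨j, hi, Sym2.eq_swap⟩

theorem ne_of_mk_mem_trail {l : List ℕ} (hn : l.Nodup) {x y : ℕ} (h : s(x, y) ∈ trail l) :
    x ≠ y := by
  rintro rfl
  obtain ⟨i, hi, rfl⟩ := List.mem_iff_getElem.1 (mem_of_mem_trail h)
  rw [mk_getElem_mem_trail hn] at h
  omega

theorem card_trail {l : List ℕ} (hn : l.Nodup) : (trail l).toFinset.card = l.length - 1 := by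
  have hlen (l : List ℕ) : (trail l).length = l.length - 1 := by
    induction l with
    | nil => rfl
    | cons a l ih => cases l <;> simp_all [trail]
  have hnd : (trail l).Nodup := by
    induction l with
    | nil => simp [trail]
    | cons a l ih =>
      cases l with
      | nil => simp [trail]
      | cons b l =>
        refine List.nodup_cons.2 ⟨fun h => ?_, ih hn.of_cons⟩
        exact (List.nodup_cons.1 hn).1 (mem_of_mem_trail h)
  rw [List.toFinset_card_of_nodup hnd, hlen]

/-- The path through the members of a list. -/
def pathSub (l : List ℕ) : NatGraph where
  verts := {x | x ∈ l}
  Adj x y := x ≠ y ∧ s(x, y) ∈ trail l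
  adj_sub h := h.1
  edge_vert h := mem_of_mem_trail h.2
  symm := ⟨fun _ _ h => ⟨h.1.symm, Sym2.eq_swap ▸ h.2⟩⟩

theorem mem_edgeSet_pathSub {l : List ℕ} (hn : l.Nodup) {e : Sym2 ℕ} :
    e ∈ (pathSub l).edgeSet ↔ e ∈ trail l := by
  induction e with | _ x y
  rw [SimpleGraph.Subgraph.mem_edgeSet]
  exact ⟨And.right, fun h => ⟨ne_of_mk_mem_trail hn h, h⟩⟩

theorem pathSub_iso {l : List ℕ} (hn : l.Nodup) :
    Nonempty ((pathSub l).coe ≃g P l.length) := by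
  refine ⟨RelIso.symm ⟨Equiv.ofBijective (fun i => ⟨l[i], by simp [pathSub]⟩) ⟨?_, ?_⟩, ?_⟩⟩
  · intro i j h
    have : l[i] = l[j] := congrArg Subtype.val h
    exact Fin.ext ((hn.getElem_inj_iff).1 this)
  · rintro ⟨x, hx⟩
    obtain ⟨i, hi, rfl⟩ := List.mem_iff_getElem.1 (show x ∈ l from hx)
    exact ⟨⟨i, hi⟩, rfl⟩
  · intro i j
    rw [SimpleGraph.pathGraph_adj, ← mk_getElem_mem_trail hn i.2 j.2]
    exact ⟨And.right, fun h => ⟨ne_of_mk_mem_trail hn h, h⟩⟩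

/-- Allows every block of a design to be treated as a list of vertices. -/
theorem exists_eq_pathSub {k : ℕ} {B : NatGraph} (h : Nonempty (B.coe ≃g P k)) :
    ∃ l : List ℕ, l.length = k ∧ l.Nodup ∧ B = pathSub l := by
  obtain ⟨f⟩ := h
  have hinj : Function.Injective fun i => (f.symm i : ℕ) :=
    Subtype.val_injective.comp f.symm.injective
  have hn : (List.ofFn fun i => (f.symm i : ℕ)).Nodup := List.nodup_ofFn.2 hinj
  refine ⟨List.ofFn fun i => (f.symm i : ℕ), by simp, hn, ?_⟩
  have hadj (x y : B.verts) : B.Adj x y ↔ s((x : ℕ), (y : ℕ)) ∈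
      trail (List.ofFn fun i => (f.symm i : ℕ)) := by
    have := mk_getElem_mem_trail hn (i := f x) (j := f y) (by simp) (by simp)
    simp only [List.getElem_ofFn, Fin.eta, RelIso.symm_apply_apply] at this
    rw [this, ← SimpleGraph.pathGraph_adj, f.map_adj_iff, SimpleGraph.Subgraph.coe_adj]
  have hverts (x : ℕ) : x ∈ (List.ofFn fun i => (f.symm i : ℕ)) ↔ x ∈ B.verts := by
    rw [List.mem_ofFn]
    constructor
    · rintro ⟨i, rfl⟩
      exact (f.symm i).2
    · intro hx
      exact ⟨f ⟨x, hx⟩, by simp⟩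
  ext x y
  · exact (hverts x).symm
  · constructor
    · intro h
      exact ⟨B.adj_sub h, (hadj ⟨x, B.edge_vert h⟩ ⟨y, B.edge_vert h.symm⟩).1 h⟩
    · rintro ⟨-, h⟩
      exact (hadj ⟨x, (hverts x).1 (mem_of_mem_trail h)⟩
        ⟨y, (hverts y).1 (mem_of_mem_trail (Sym2.eq_swap ▸ h))⟩).2 h

theorem pathSub_le {l l' : List ℕ} (h : l' ⊆ l) (ht : trail l' ⊆ trail l) :
    pathSub l' ≤ pathSub l :=
  ⟨fun _ hx => h hx, fun _ _ hxy => ⟨hxy.1, ht hxy.2⟩⟩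

/-! ### From decompositions of edge sets to designs and down-links -/

/-- `𝓑` is a decomposition of the graph with edge set `F` into paths with `k` vertices. -/
structure IsPathDec (k : ℕ) (F : Finset (Sym2 ℕ)) (𝓑 : Set NatGraph) : Prop where
  iso : ∀ B ∈ 𝓑, Nonempty (B.coe ≃g P k)
  subset : ∀ B ∈ 𝓑, B.edgeSet ⊆ F
  partition : ∀ e ∈ F, ∃! B, B ∈ 𝓑 ∧ e ∈ B.edgeSet

theorem mem_edgeSet_completeOn {S : Finset ℕ} {e : Sym2 ℕ} :
    e ∈ (completeOn S).edgeSet ↔ e ∈ completeEdges S := by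
  induction e with | _ x y
  simp [completeOn, mk_mem_completeEdges]

/-- As `k ≥ 2`, every vertex of a path lies on an edge, so containment of edges already forces
containment of vertices. -/
theorem isDesign_iff {k : ℕ} (hk : 2 ≤ k) {S : Finset ℕ} {𝓑 : Set NatGraph} :
    IsDesign (completeOn S) (P k) 𝓑 ↔ IsPathDec k (completeEdges S) 𝓑 := by
  constructor
  · rintro ⟨h₁, h₂, h₃⟩
    exact ⟨h₂, fun B hB e he => mem_edgeSet_completeOn.1
      (SimpleGraph.Subgraph.edgeSet_mono (h₁ B hB) he),
      fun e he => h₃ e (mem_edgeSet_completeOn.2 he)⟩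
  · rintro ⟨h₁, h₂, h₃⟩
    refine ⟨fun B hB => ?_, h₁, fun e he => h₃ e (mem_edgeSet_completeOn.1 he)⟩
    have hadj {x y : ℕ} (h : B.Adj x y) : x ∈ S ∧ y ∈ S ∧ x ≠ y :=
      mk_mem_completeEdges.1 (h₂ B hB (SimpleGraph.Subgraph.mem_edgeSet.2 h))
    refine ⟨fun x hx => ?_, fun x y h => ?_⟩
    · obtain ⟨l, hl, hn, rfl⟩ := exists_eq_pathSub (h₁ B hB)
      obtain ⟨y, hy⟩ := exists_mem_trail (hl ▸ hk) (show x ∈ l from hx)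
      exact (hadj ⟨ne_of_mk_mem_trail hn hy, hy⟩).1
    · simpa [completeOn] using hadj h

/-- Send each edge to its block: the nonempty fibres are the edge sets of blocks, of size `k - 1`.
No finiteness of the set of blocks is needed in advance. -/
theorem IsPathDec.dvd_card {k : ℕ} {F : Finset (Sym2 ℕ)} {𝓑 : Set NatGraph}
    (h : IsPathDec k F 𝓑) : k - 1 ∣ F.card := by
  classical
  choose! f hf using fun e he => (h.partition e he).exists
  rw [card_eq_sum_card_image f]
  refine dvd_sum fun B hB => ?_
  obtain ⟨e, he, rfl⟩ := mem_image.1 hB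
  obtain ⟨l, hl, hn, hB⟩ := exists_eq_pathSub (h.iso _ (hf e he).1)
  suffices {a ∈ F | f a = f e} = (trail l).toFinset by rw [this, card_trail hn, hl]
  ext a
  rw [mem_filter, List.mem_toFinset, ← mem_edgeSet_pathSub hn, ← hB]
  constructor
  · rintro ⟨ha, h⟩
    exact h ▸ (hf a ha).2
  · intro ha
    have haF := h.subset _ (hf e he).1 ha
    exact ⟨haF, (h.partition a haF).unique (hf a haF) ⟨(hf e he).1, ha⟩⟩

theorem isPathDec_empty (k : ℕ) : IsPathDec k ∅ ∅ :=
  ⟨by simp, by simp, by simp⟩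

theorem isPathDec_singleton {l : List ℕ} (hn : l.Nodup) :
    IsPathDec l.length (trail l).toFinset {pathSub l} := by
  refine ⟨?_, ?_, ?_⟩
  · rintro _ rfl
    exact pathSub_iso hn
  · rintro _ rfl e he
    simpa using (mem_edgeSet_pathSub hn).1 he
  · intro e he
    exact ⟨_, ⟨rfl, (mem_edgeSet_pathSub hn).2 (by simpa using he)⟩, fun _ h => h.1⟩

theorem IsPathDec.union {k : ℕ} {F F' : Finset (Sym2 ℕ)} {𝓑 𝓑' : Set NatGraph}
    (h : IsPathDec k F 𝓑) (h' : IsPathDec k F' 𝓑') (hd : Disjoint F F') :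
    IsPathDec k (F ∪ F') (𝓑 ∪ 𝓑') := by
  have key {F F' : Finset (Sym2 ℕ)} {𝓑 𝓑' : Set NatGraph} (h : IsPathDec k F 𝓑)
      (h' : IsPathDec k F' 𝓑') (hd : Disjoint F F') (e : Sym2 ℕ) (he : e ∈ F) :
      ∃! B, B ∈ 𝓑 ∪ 𝓑' ∧ e ∈ B.edgeSet := by
    obtain ⟨B, ⟨hB, heB⟩, hu⟩ := h.partition e he
    refine ⟨B, ⟨.inl hB, heB⟩, fun C hC => ?_⟩
    rcases hC.1 with hC' | hC'
    · exact hu C ⟨hC', hC.2⟩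
    · exact absurd (h'.subset C hC' hC.2) (Finset.disjoint_left.1 hd he)
  refine ⟨?_, ?_, fun e he => ?_⟩
  · rintro B (hB | hB)
    exacts [h.iso B hB, h'.iso B hB]
  · rintro B (hB | hB) e he
    exacts [mem_union_left _ (h.subset B hB he), mem_union_right _ (h'.subset B hB he)]
  · rcases mem_union.1 he with he | he
    · exact key h h' hd e he
    · rw [Set.union_comm]
      exact key h' h hd.symm e he

theorem P4Dec.exists_isPathDec {F : Finset (Sym2 ℕ)} (h : P4Dec F) :
    ∃ 𝓑, IsPathDec 4 F 𝓑 := by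
  induction h with
  | empty => exact ⟨_, isPathDec_empty 4⟩
  | add a b c d F hn hd _ ih =>
    obtain ⟨𝓑, h⟩ := ih
    exact ⟨_, (isPathDec_singleton hn).union h hd⟩

theorem insert_union_sdiff_insert {α : Type*} [DecidableEq α] {x : α} {T E L : Finset α}
    (hx : x ∉ T) (hd : Disjoint (insert x T) E) (hL : L ⊆ E) :
    (insert x T ∪ E) \ insert x L = T ∪ (E \ L) := by
  ext f
  have := @hL f
  have h' : f ∈ insert x T → f ∉ E := fun h => Finset.disjoint_left.1 hd h
  simp only [mem_sdiff, mem_union, mem_insert] at h' ⊢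
  grind

/-- Removing the marked end edge of each P_5 leaves a P_4 inside it, and these P_4's cover exactly
the unmarked edges. -/
theorem Marked.exists_isPathDec {E L : Finset (Sym2 ℕ)} {I : Finset ℕ} (h : Marked E L I) :
    ∃ 𝓑 𝓑₀, IsPathDec 5 E 𝓑 ∧ IsPathDec 4 (E \ L) 𝓑₀ ∧ (∀ B ∈ 𝓑, ∃ B' ∈ 𝓑₀, B' ≤ B) ∧
      ∀ x ∈ I, ∃ a b c d e, pathSub [a, b, c, d, e] ∈ 𝓑 ∧ [a, b, c, d, e].Nodup ∧
        (x = b ∨ x = c ∨ x = d) := by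
  induction h with
  | empty => exact ⟨_, _, isPathDec_empty 5, isPathDec_empty 4, by simp, by simp⟩
  | add a b c d e E L I hn hd hM ih =>
    obtain ⟨𝓑, 𝓑₀, h₁, h₂, h₃, h₄⟩ := ih
    have hsub : (trail [b, c, d, e]).toFinset ⊆ (trail [a, b, c, d, e]).toFinset := by
      intro; simp +contextual [trail]
    have heq : ((trail [a, b, c, d, e]).toFinset ∪ E) \ insert s(a, b) L =
        (trail [b, c, d, e]).toFinset ∪ (E \ L) := by
      have ht : (trail [a, b, c, d, e]).toFinset =
          insert s(a, b) (trail [b, c, d, e]).toFinset := by simp [trail]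
      rw [ht] at hd ⊢
      refine insert_union_sdiff_insert (fun h => ?_) hd hM.subset
      exact (List.nodup_cons.1 hn).1 (mem_of_mem_trail (List.mem_toFinset.1 h))
    refine ⟨{pathSub [a, b, c, d, e]} ∪ 𝓑, {pathSub [b, c, d, e]} ∪ 𝓑₀,
      (isPathDec_singleton hn).union h₁ hd, ?_, ?_, ?_⟩
    · rw [heq]
      exact (isPathDec_singleton (List.nodup_cons.1 hn).2).union h₂
        (hd.mono hsub sdiff_subset)
    · rintro B (rfl | hB)
      · exact ⟨_, .inl rfl, pathSub_le (by simp) (by intro; simp +contextual [trail])⟩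
      · obtain ⟨B', hB', hle⟩ := h₃ B hB
        exact ⟨B', .inr hB', hle⟩
    · intro x hx
      simp only [mem_union, mem_insert, mem_singleton] at hx
      rcases hx with hx | hx
      · exact ⟨a, b, c, d, e, .inl rfl, hn, hx⟩
      · obtain ⟨a, b, c, d, e, h, h'⟩ := h₄ x hx
        exact ⟨a, b, c, d, e, .inr h, h'⟩

/-- Any decomposition into paths with five vertices can be linked to a set of paths with four
vertices. -/
theorem IsPathDec.exists_shorter {E : Finset (Sym2 ℕ)} {𝓑 : Set NatGraph}
    (h : IsPathDec 5 E 𝓑) :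
    ∃ F ⊆ E, ∃ 𝓑₀, IsPathDec 4 F 𝓑₀ ∧ ∀ B ∈ 𝓑, ∃ B' ∈ 𝓑₀, B' ≤ B := by
  classical
  have key : ∀ B ∈ 𝓑, ∃ B' : NatGraph, Nonempty (B'.coe ≃g P 4) ∧ B' ≤ B := by
    intro B hB
    obtain ⟨l, hl, hn, rfl⟩ := exists_eq_pathSub (h.iso B hB)
    match l, hl with
    | [a, b, c, d, e], _ =>
      exact ⟨pathSub [b, c, d, e], pathSub_iso (List.nodup_cons.1 hn).2,
        pathSub_le (by simp) (by intro; simp +contextual [trail])⟩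
  choose! g hg hle using key
  refine ⟨{e ∈ E | ∃ B ∈ 𝓑, e ∈ (g B).edgeSet}, filter_subset _ _, g '' 𝓑, ⟨?_, ?_, ?_⟩, ?_⟩
  · rintro _ ⟨B, hB, rfl⟩
    exact hg B hB
  · rintro _ ⟨B, hB, rfl⟩ e he
    exact mem_coe.2 (mem_filter.2
      ⟨h.subset B hB (SimpleGraph.Subgraph.edgeSet_mono (hle B hB) he), B, hB, he⟩)
  · intro e he
    obtain ⟨heE, B, hB, heB⟩ := mem_filter.1 he
    refine ⟨g B, ⟨⟨B, hB, rfl⟩, heB⟩, ?_⟩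
    rintro _ ⟨⟨C, hC, rfl⟩, heC⟩
    rw [(h.partition e heE).unique
      ⟨hC, SimpleGraph.Subgraph.edgeSet_mono (hle C hC) heC⟩
      ⟨hB, SimpleGraph.Subgraph.edgeSet_mono (hle B hB) heB⟩]
  · exact fun B hB => ⟨g B, ⟨B, hB, rfl⟩, hle B hB⟩

/-- Extending a set of paths to a design and thereby obtaining a down-link. -/
theorem exists_design_of_p4Dec {𝓑 𝓑₀ : Set NatGraph} {F : Finset (Sym2 ℕ)} {S : Finset ℕ}
    (h : IsPathDec 4 F 𝓑₀) (hle : ∀ B ∈ 𝓑, ∃ B' ∈ 𝓑₀, B' ≤ B) (hF : F ⊆ completeEdges S)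
    (hP : P4Dec (completeEdges S \ F)) :
    ∃ 𝓑', IsDesignOfOrder (P 4) S.card 𝓑' ∧ DownLinkable 𝓑 𝓑' := by
  obtain ⟨𝓑₁, h₁⟩ := hP.exists_isPathDec
  have := h.union h₁ disjoint_sdiff
  rw [union_sdiff_of_subset hF] at this
  refine ⟨𝓑₀ ∪ 𝓑₁, ⟨S, rfl, (isDesign_iff (by norm_num)).2 this⟩, ?_⟩
  choose! f hf hfle using hle
  exact ⟨fun B => ⟨f B, .inl (hf B B.2)⟩, fun B => hfle B B.2⟩

/-! ### Necessary conditions -/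

theorem two_mul_choose_two (n : ℕ) : 2 * n.choose 2 + n = n * n := by
  induction n with
  | zero => rfl
  | succ n ih =>
    rw [Nat.choose_succ_succ' n 1, Nat.choose_one_right, one_add_one_eq_two]
    linarith

theorem three_dvd_choose_two {n : ℕ} : 3 ∣ n.choose 2 ↔ n % 3 = 0 ∨ n % 3 = 1 := by
  have h := two_mul_choose_two n
  obtain ⟨q, r, hr, rfl⟩ : ∃ q r, r < 3 ∧ n = 3 * q + r := ⟨n / 3, n % 3, by omega, by omega⟩
  have hq : (3 * q + r) * (3 * q + r) = 9 * (q * q) + 6 * (q * r) + r * r := by ring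
  rw [hq] at h
  interval_cases r <;> omega

theorem four_dvd_choose_two {n : ℕ} (h4 : 4 ∣ n.choose 2) : n % 8 = 0 ∨ n % 8 = 1 := by
  have h := two_mul_choose_two n
  obtain ⟨q, r, hr, rfl⟩ : ∃ q r, r < 8 ∧ n = 8 * q + r := ⟨n / 8, n % 8, by omega, by omega⟩
  have hq : (8 * q + r) * (8 * q + r) = 64 * (q * q) + 16 * (q * r) + r * r := by ring
  rw [hq] at h
  interval_cases r <;> omega

theorem IsDesignOfOrder.dvd_choose {k n : ℕ} {𝓑 : Set NatGraph} (hk : 2 ≤ k)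
    (h : IsDesignOfOrder (P k) n 𝓑) : k - 1 ∣ n.choose 2 := by
  obtain ⟨S, rfl, h⟩ := h
  rw [← card_completeEdges]
  exact ((isDesign_iff hk).1 h).dvd_card

theorem verts_subset_of_isDesign {S : Finset ℕ} {W : Type} {Γ : SimpleGraph W}
    {𝓑 : Set NatGraph} (h : IsDesign (completeOn S) Γ 𝓑) {B : NatGraph} (hB : B ∈ 𝓑) :
    B.verts ⊆ S := by
  intro x hx
  simpa [completeOn] using (h.le B hB).1 hx

/-- If `x` and `y` were both missing, the block through the edge xy would contain them and the four
vertices of its image, six vertices on a P_5. -/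
theorem card_sdiff_le_one {S S' : Finset ℕ} {𝓑 𝓑' : Set NatGraph}
    (h : IsDesign (completeOn S) (P 5) 𝓑) (h' : IsDesign (completeOn S') (P 4) 𝓑')
    (hl : DownLinkable 𝓑 𝓑') : (S \ S').card ≤ 1 := by
  obtain ⟨f, hf⟩ := hl
  refine card_le_one.2 fun x hx y hy => ?_
  by_contra hxy
  rw [mem_sdiff] at hx hy
  obtain ⟨B, ⟨hB, hxyB⟩, -⟩ := h.partition s(x, y)
    (mem_edgeSet_completeOn.2 (mk_mem_completeEdges.2 ⟨hx.1, hy.1, hxy⟩))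
  have hle := hf ⟨B, hB⟩
  have hsub := verts_subset_of_isDesign h' (f ⟨B, hB⟩).2
  obtain ⟨l', hl', hn', heq'⟩ := exists_eq_pathSub (h'.iso _ (f ⟨B, hB⟩).2)
  rw [heq'] at hle hsub
  obtain ⟨l, hl, hn, rfl⟩ := exists_eq_pathSub (h.iso B hB)
  have hxl : x ∈ l := (pathSub l).edge_vert hxyB
  have hyl : y ∈ l := (pathSub l).edge_vert (SimpleGraph.Subgraph.Adj.symm hxyB)
  have hsub' : insert x (insert y l'.toFinset) ⊆ l.toFinset := by
    simp only [insert_subset_iff, List.mem_toFinset, hxl, hyl, true_and]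
    exact fun z hz => List.mem_toFinset.2 (hle.1 (List.mem_toFinset.1 hz))
  have hcard := card_le_card hsub'
  have hyl' : y ∉ l' := fun hz => hy.2 (hsub hz)
  have hxl' : x ∉ l' := fun hz => hx.2 (hsub hz)
  rw [card_insert_of_notMem (by simp [hxy, hxl']), card_insert_of_notMem (by simpa using hyl'),
    List.toFinset_card_of_nodup hn', List.toFinset_card_of_nodup hn] at hcard
  omega

/-- Deleting an interior vertex of a path with five vertices leaves no path with four vertices. -/
theorem mem_verts_of_interior {a b c d e x : ℕ} (hn : [a, b, c, d, e].Nodup)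
    (hx : x = b ∨ x = c ∨ x = d) {B : NatGraph} (hB : Nonempty (B.coe ≃g P 4))
    (hle : B ≤ pathSub [a, b, c, d, e]) : x ∈ B.verts := by
  obtain ⟨l, hl, hnl, rfl⟩ := exists_eq_pathSub hB
  by_contra hxl
  have hsub : ∀ f ∈ trail l, f ∈ trail [a, b, c, d, e] ∧ x ∉ f := by
    intro f hf
    induction f with | _ y z
    refine ⟨(hle.2 ⟨ne_of_mk_mem_trail hnl hf, hf⟩).2, fun hxf => hxl ?_⟩
    rcases Sym2.mem_iff.1 hxf with rfl | rfl
    · exact mem_of_mem_trail hf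
    · exact mem_of_mem_trail (Sym2.eq_swap ▸ hf)
  have hcard := card_trail hnl
  -- An interior vertex lies on two of the four edges, so at most two remain, whereas a P_4 has
  -- three.
  have hT : ∃ u v : Sym2 ℕ, (trail l).toFinset ⊆ {u, v} := by
    rcases hx with rfl | rfl | rfl
    · refine ⟨s(c, d), s(d, e), fun f hf => ?_⟩
      obtain ⟨h₁, h₂⟩ := hsub f (List.mem_toFinset.1 hf)
      simp only [trail, List.mem_cons, List.not_mem_nil, or_false] at h₁
      rcases h₁ with rfl | rfl | rfl | rfl <;> simp at h₂ ⊢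
    · refine ⟨s(a, b), s(d, e), fun f hf => ?_⟩
      obtain ⟨h₁, h₂⟩ := hsub f (List.mem_toFinset.1 hf)
      simp only [trail, List.mem_cons, List.not_mem_nil, or_false] at h₁
      rcases h₁ with rfl | rfl | rfl | rfl <;> simp at h₂ ⊢
    · refine ⟨s(a, b), s(b, c), fun f hf => ?_⟩
      obtain ⟨h₁, h₂⟩ := hsub f (List.mem_toFinset.1 hf)
      simp only [trail, List.mem_cons, List.not_mem_nil, or_false] at h₁
      rcases h₁ with rfl | rfl | rfl | rfl <;> simp at h₂ ⊢
  obtain ⟨u, v, hT⟩ := hT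
  have := (card_le_card hT).trans card_le_two
  omega

/-! ### Membership in the two spectra -/

theorem subset_spectrum₁_necessary (v : ℕ) : spectrum₁ (P 5) (P 4) v ⊆
    {n | v - 1 ≤ n ∧ (n % 3 = 0 ∨ n % 3 = 1)} := by
  rintro n ⟨𝓑, ⟨S, rfl, h⟩, 𝓑', h', hl⟩
  refine ⟨?_, three_dvd_choose_two.1 (h'.dvd_choose (by norm_num))⟩
  obtain ⟨S', rfl, h'⟩ := h'
  have h₁ := card_sdiff_le_one h h' hl
  have h₂ := le_card_sdiff S' S
  omega

/-- A marked decomposition of a complete graph into paths with five vertices gives a design that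
is linked to a design of paths with four vertices as soon as the remaining edges decompose. -/
theorem Marked.exists_designs {S S' : Finset ℕ} {L : Finset (Sym2 ℕ)} {I : Finset ℕ}
    (h : Marked (completeEdges S) L I) (hF : completeEdges S \ L ⊆ completeEdges S')
    (hP : P4Dec (completeEdges S' \ (completeEdges S \ L))) :
    S'.card ∈ spectrum₁ (P 5) (P 4) S.card := by
  obtain ⟨𝓑, 𝓑₀, h₁, h₂, h₃, -⟩ := h.exists_isPathDec
  exact ⟨𝓑, ⟨S, rfl, (isDesign_iff (by norm_num)).2 h₁⟩, exists_design_of_p4Dec h₂ h₃ hF hP⟩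

theorem Marked.three_dvd {E L : Finset (Sym2 ℕ)} {I : Finset ℕ} (h : Marked E L I) :
    3 ∣ (E \ L).card := by
  obtain ⟨𝓑, 𝓑₀, -, h, -, -⟩ := h.exists_isPathDec
  exact h.dvd_card

theorem sub_one_mem_spectrum₁ {v : ℕ} (h₀ : 8 ≤ v) (h₁ : v % 8 = 0 ∨ v % 8 = 1)
    (h₂ : (v - 1) % 3 = 0 ∨ (v - 1) % 3 = 1) : v - 1 ∈ spectrum₁ (P 5) (P 4) v := by
  -- The P_5-design lives on `range (v - 1)` with root `v`; any root outside the range would do.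
  obtain ⟨L, I, hM, hL, hP⟩ := rootedSplit_of_card (x := v) (V := range (v - 1)) (by simp)
    (by rw [card_range]; omega)
  have hv : v ∉ range (v - 1) := by simp
  have heq : completeEdges (range (v - 1)) \ (completeEdges (insert v (range (v - 1))) \
      (cone v (range (v - 1)) ∪ L)) = L := by
    ext e
    have := @hL e
    induction e with | _ x y
    simp only [mem_sdiff, mem_union, mk_mem_completeEdges, mk_mem_cone, mem_insert] at this ⊢
    grind
  have := hM.exists_designs (S' := range (v - 1)) (by
    intro e
    induction e with | _ x y
    simp only [mem_sdiff, mem_union, mk_mem_completeEdges, mk_mem_cone, mem_insert]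
    grind) (by rwa [heq])
  rwa [card_insert_of_notMem hv, card_range, Nat.sub_add_cancel (by omega)] at this

theorem self_mem_spectrum₁ {v : ℕ} (h₀ : 8 ≤ v) (h₁ : v % 8 = 0 ∨ v % 8 = 1)
    (h₂ : v % 3 = 0 ∨ v % 3 = 1) : v ∈ spectrum₁ (P 5) (P 4) v := by
  obtain ⟨L, I, hM, hP⟩ := completeSplit_of_card (V := range v) (by rw [card_range]; omega)
    (by rw [card_range]; omega)
  have := hM.exists_designs (S' := range v) sdiff_subset
    (by rwa [Finset.sdiff_sdiff_eq_self hM.subset])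
  rwa [card_range] at this

/-- The hubs are the root `v`, which lies on no shortened path, and the new vertex `v + 1`. -/
theorem add_one_mem_spectrum₁ {v : ℕ} (h₀ : 8 ≤ v) (h₁ : v % 8 = 0 ∨ v % 8 = 1)
    (h₂ : (v + 1) % 3 = 0 ∨ (v + 1) % 3 = 1) : v + 1 ∈ spectrum₁ (P 5) (P 4) v := by
  obtain ⟨L, I, hM, hL⟩ := rooted_of_card (x := v) (V := range (v - 1)) (by simp)
    (by rw [card_range]; omega) (by rw [card_range]; omega)
  have hv : v ∉ range (v - 1) := by simp
  have hv' : v + 1 ∉ insert v (range (v - 1)) := by simp; omega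
  have hF : completeEdges (insert v (range (v - 1))) \ L ⊆
      completeEdges (insert (v + 1) (insert v (range (v - 1))) \ {v, v + 1}) := by
    intro e
    have := @hL e
    induction e with | _ x y
    simp only [mem_sdiff, mem_singleton, mk_mem_completeEdges, mk_mem_cone, mem_insert,
      mem_range] at this ⊢
    grind
  have hc : (insert (v + 1) (insert v (range (v - 1)))).card = v + 1 := by
    rw [card_insert_of_notMem hv', card_insert_of_notMem hv, card_range]
    omega
  have := hM.exists_designs (hF.trans (completeEdges_mono sdiff_subset))
    (p4Dec_completeEdges_sdiff (p := v) (q := v + 1) (by omega) (by simp) (by simp) hF (by omega)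
      (by rw [card_completeEdges, hc]; exact three_dvd_choose_two.2 h₂) hM.three_dvd)
  rwa [hc, card_insert_of_notMem hv, card_range, Nat.sub_add_cancel (by omega)] at this

/-- Two vertices outside `S` serve as hubs, so any choice of end edges to delete works. -/
theorem mem_spectrum₂_of_add_two_le {v n : ℕ} (h₀ : 8 ≤ v) (h₁ : v + 2 ≤ n)
    (h₂ : n % 3 = 0 ∨ n % 3 = 1) : n ∈ spectrum₂ (P 5) (P 4) v := by
  rintro 𝓑 ⟨S, rfl, h⟩
  obtain ⟨F, hFS, 𝓑₀, hF, hle⟩ := ((isDesign_iff (by norm_num)).1 h).exists_shorter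
  obtain ⟨S', hS, rfl⟩ := Infinite.exists_superset_card_eq S n (by omega)
  have hcard := card_sdiff_of_subset hS
  obtain ⟨p, hp, q, hq, hpq⟩ := one_lt_card.1 (show 1 < (S' \ S).card by omega)
  rw [mem_sdiff] at hp hq
  have hsub : S ⊆ S' \ {p, q} := fun x hx => by
    have := ne_of_mem_of_not_mem hx hp.2
    have := ne_of_mem_of_not_mem hx hq.2
    simp [hS hx, *]
  exact exists_design_of_p4Dec hF hle (hFS.trans (completeEdges_mono hS))
    (p4Dec_completeEdges_sdiff hpq hp.1 hq.1 (hFS.trans (completeEdges_mono hsub)) (by omega)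
      (by rw [card_completeEdges]; exact three_dvd_choose_two.2 h₂) hF.dvd_card)

/-- Some vertex is missing from the smaller complete graph, but it is interior to a block, whose
image must then contain it. -/
theorem sub_one_notMem_spectrum₂ {v : ℕ} (h₀ : 8 ≤ v) (h₁ : v % 8 = 0 ∨ v % 8 = 1) :
    v - 1 ∉ spectrum₂ (P 5) (P 4) v := by
  intro hmem
  obtain ⟨L, I, hM, hI⟩ := allInterior_of_card (V := range v) (by rwa [card_range])
    (by rwa [card_range])
  obtain ⟨𝓑, -, h₁, -, -, hint⟩ := hM.exists_isPathDec
  obtain ⟨𝓑', ⟨S', hS', h'⟩, f, hf⟩ :=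
    hmem 𝓑 ⟨range v, card_range v, (isDesign_iff (by norm_num)).2 h₁⟩
  obtain ⟨x, hx, hxS⟩ := exists_mem_notMem_of_card_lt_card (s := S') (t := range v)
    (by rw [card_range]; omega)
  obtain ⟨a, b, c, d, e, hB, hn, hxi⟩ := hint x (hI hx)
  exact hxS (verts_subset_of_isDesign h' (f ⟨_, hB⟩).2
    (mem_verts_of_interior hn hxi (h'.iso _ (f ⟨_, hB⟩).2) (hf ⟨_, hB⟩)))

end DownLink

theorem theorem4p5 (v : ℕ) (hv : 1 < v) (hadm : DownLink.Admissible (DownLink.P 5) v) :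
    DownLink.spectrum₁ (DownLink.P 5) (DownLink.P 4) v =
        {n : ℕ | v - 1 ≤ n ∧ (n ≡ 0 [MOD 3] ∨ n ≡ 1 [MOD 3])} ∧
      {n : ℕ | v + 2 ≤ n ∧ (n ≡ 0 [MOD 3] ∨ n ≡ 1 [MOD 3])} ⊆
        DownLink.spectrum₂ (DownLink.P 5) (DownLink.P 4) v ∧
      DownLink.spectrum₂ (DownLink.P 5) (DownLink.P 4) v ⊆
        {n : ℕ | v ≤ n ∧ (n ≡ 0 [MOD 3] ∨ n ≡ 1 [MOD 3])} := by
  have hmod (n : ℕ) : (n ≡ 0 [MOD 3] ∨ n ≡ 1 [MOD 3]) ↔ (n % 3 = 0 ∨ n % 3 = 1) := Iff.rfl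
  simp only [hmod]
  obtain ⟨𝓑, h𝓑⟩ := hadm
  have h8 := DownLink.four_dvd_choose_two (h𝓑.dvd_choose (by norm_num))
  have h₀ : 8 ≤ v := by omega
  -- Admissibility supplies a design, so the universal condition is not vacuous and implies the
  -- existential one.
  have h₂₁ : DownLink.spectrum₂ (DownLink.P 5) (DownLink.P 4) v ⊆
      DownLink.spectrum₁ (DownLink.P 5) (DownLink.P 4) v := fun n hn => ⟨𝓑, h𝓑, hn 𝓑 h𝓑⟩
  have h₁ := DownLink.subset_spectrum₁_necessary v
  refine ⟨h₁.antisymm ?_, fun n hn => DownLink.mem_spectrum₂_of_add_two_le h₀ hn.1 hn.2,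
    fun n hn => ?_⟩
  · rintro n ⟨hn, h3⟩
    obtain rfl | rfl | rfl | hn' : n = v - 1 ∨ n = v ∨ n = v + 1 ∨ v + 2 ≤ n := by omega
    · exact DownLink.sub_one_mem_spectrum₁ h₀ h8 h3
    · exact DownLink.self_mem_spectrum₁ h₀ h8 h3
    · exact DownLink.add_one_mem_spectrum₁ h₀ h8 h3
    · exact h₂₁ (DownLink.mem_spectrum₂_of_add_two_le h₀ hn' h3)
  · obtain ⟨hn', h3⟩ := h₁ (h₂₁ hn)
    have hne : n ≠ v - 1 := by
      rintro rfl
      exact DownLink.sub_one_notMem_spectrum₂ h₀ h8 hn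
    exact ⟨by omega, h3⟩
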